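/- Let $1\le N_T\le N_R$ and $N=N_R-N_T+1$. Write $(x)_n=x(x+1)\cdots(x+n-1)$, $(x)_0=1$, and ${}_1F_1(b;c;z)=\sum_{n\ge 0}\frac{(b)_n}{(c)_n}\frac{z^n}{n!}$. **Finite expansion.** For every $\sigma\in\mathbb C$ the series ${}_1F_1(N;N_R;\sigma)$ converges. If $N_T=1$, then ${}_1F_1(N;N_R;\sigma)=e^{\sigma}$. If $N_T\ge 2$, then for every $\sigma\in\mathbb C\setminus\{0\}$ $${}_1F_1(N;N_R;\sigma)=A(\sigma)+e^{\sigma}B(\sigma),$$ where $$A(\sigma)=\frac{(-1)^N(N_R-1)!}{(N_R-N-1)!}\sum_{k=0}^{N_R-N-1}\binom{N_R-N-1}{k}(N)_k\,\sigma^{-N-k},$$ $$B(\sigma)=\frac{(-1)^{N_R-N}(N_R-1)!}{(N-1)!}\sum_{k=0}^{N-1}\binom{N-1}{k}(N_R-N)_k\,(-\sigma)^{-N_R+N-k}.$$ **Moment generating function.** Let $K>0$ and let $\mathbf H=\sqrt{\tfrac{K}{K+1}}\,\mathbf H_{\rm dn}+\sqrt{\tfrac1{K+1}}\,\mathbf H_{\rm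 rn}$ be a random $N_R\times N_T$ complex matrix (the channel matrix) with Rician–Rayleigh fading: $\mathbf H_{\rm dn}$ is deterministic, its first column is nonzero and all its other columns vanish; the rows of $\mathbf H_{\rm rn}$ are independent, and each conjugate-transposed row of $\mathbf H_{\rm rn}$ is circularly-symmetric complex Gaussian with mean $\mathbf 0$ and positive definite covariance matrix $\mathbf R_T$. Let $\mathbf R_{T,K}=\frac1{K+1}\mathbf R_T$, let $\Gamma_{\rm s}>0$, and let $$\gamma_1=\frac{\Gamma_{\rm s}}{[(\mathbf H^{\mathcal H}\mathbf H)^{-1}]_{1,1}}$$ be the zero-forcing SNR of stream 1 (it is defined almost surely). Put $\Gamma_1=\Gamma_{\rm s}/[\mathbf R_{T,K}^{-1}]_{1,1}$ and $a=[\mathbf R_{T,K}^{-1}]_{1,1}\,\|\mathbf h_{{\rm d},1}\|^2$, where $\mathbf h_{{\rm d},1}$ is the first column of $\sqrt{\tfrac{K}{K+1}}\,\mathbf H_{\rm dn}$. For every real $s$ with $\Gamma_1 s<1$, let $\sigma=\frac{a\Gamma_1 s}{1-\Gamma_1 s}$. Then $e^{s\gamma_1}$ is integrable, and $M_{\gamma_1}(s)=\mathbb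 E\{e^{s\gamma_1}\}$ satisfies $$M_{\gamma_1}(s)=\frac{1}{(1-\Gamma_1 s)^N}\,{}_1F_1(N;N_R;\sigma),$$ so that $$M_{\gamma_1}(s)=\begin{cases}\dfrac{1}{(1-\Gamma_1 s)^N}\,e^{\sigma},& N_T=1,\\[2mm] \dfrac{1}{(1-\Gamma_1 s)^N}\left[A(\sigma)+e^{\sigma}B(\sigma)\right],& N_T\ge 2,\ s\ne 0.\end{cases}$$ -/

import Mathlib

open MeasureTheory ProbabilityTheory Matrix
open scoped Nat BigOperators ComplexOrder

noncomputable section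

/-- The `n`-th term `(b)_n / (c)_n * z ^ n / n!` of the confluent hypergeometric series
`₁F₁(b; c; z)`; here `(b)_n = b (b + 1) ⋯ (b + n - 1)`. -/
def kummerTerm {𝕜 : Type*} [RCLike 𝕜] (b c z : 𝕜) (n : ℕ) : 𝕜 :=
  (ascPochhammer 𝕜 n).eval b / (ascPochhammer 𝕜 n).eval c * (z ^ n / (n ! : 𝕜))

/-- The confluent hypergeometric function `₁F₁(b; c; z)`. -/
def kummer1F1 {𝕜 : Type*} [RCLike 𝕜] (b c z : 𝕜) : 𝕜 :=
  ∑' n : ℕ, kummerTerm b c z n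

/-- The part of the finite expansion of `₁F₁(N; M; σ)`, `1 ≤ N < M`, without exponential:
`(-1)^N (M-1)! / (M-N-1)! * ∑_{k=0}^{M-N-1} C(M-N-1, k) (N)_k σ^(-N-k)`. -/
def kummerAlgPart {𝕜 : Type*} [RCLike 𝕜] (N M : ℕ) (σ : 𝕜) : 𝕜 :=
  (-1) ^ N * (((M - 1)! : ℕ) : 𝕜) / (((M - N - 1)! : ℕ) : 𝕜) *
    ∑ k ∈ Finset.range (M - N),
      ((M - N - 1).choose k : 𝕜) * (ascPochhammer 𝕜 k).eval (N : 𝕜) * (σ⁻¹) ^ (N + k)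

/-- The factor of `exp σ` in the finite expansion of `₁F₁(N; M; σ)`, `1 ≤ N < M`:
`(-1)^(M-N) (M-1)! / (N-1)! * ∑_{k=0}^{N-1} C(N-1, k) (M-N)_k (-σ)^(-(M-N)-k)`. -/
def kummerExpPart {𝕜 : Type*} [RCLike 𝕜] (N M : ℕ) (σ : 𝕜) : 𝕜 :=
  (-1) ^ (M - N) * (((M - 1)! : ℕ) : 𝕜) / (((N - 1)! : ℕ) : 𝕜) *
    ∑ k ∈ Finset.range N,
      ((N - 1).choose k : 𝕜) * (ascPochhammer 𝕜 k).eval ((M - N : ℕ) : 𝕜) *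
        ((-σ)⁻¹) ^ (M - N + k)

/-- `X ∼ 𝒞𝒩(m, R)`: the random vector `X` is circularly-symmetric complex Gaussian with mean `m`
and covariance `R = 𝔼[(X - m) (X - m)ᴴ]`, expressed by its characteristic function
`𝔼[exp (i Re (tᴴ X))] = exp (i Re (tᴴ m) - tᴴ R t / 4)`. -/
def IsComplexGaussian {Ω : Type*} [MeasurableSpace Ω] {ι : Type*} [Fintype ι]
    (P : Measure Ω) (X : Ω → ι → ℂ) (m : ι → ℂ) (R : Matrix ι ι ℂ) : Prop :=
  AEMeasurable X P ∧
    ∀ t : ι → ℂ,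
      ∫ ω, Complex.exp (Complex.I * ((star t ⬝ᵥ X ω).re : ℂ)) ∂P =
        Complex.exp (Complex.I * ((star t ⬝ᵥ m).re : ℂ) - (star t ⬝ᵥ (R *ᵥ t)) / 4)

/-- The channel matrix `H = √(K/(K+1)) H_dn + √(1/(K+1)) H_rn`. -/
def channelMatrix {NR NT : ℕ} (K : ℝ) (Hdn Hrn : Matrix (Fin NR) (Fin NT) ℂ) :
    Matrix (Fin NR) (Fin NT) ℂ :=
  ((Real.sqrt (K / (K + 1)) : ℝ) : ℂ) • Hdn + ((Real.sqrt (1 / (K + 1)) : ℝ) : ℂ) • Hrn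

/-- Rician–Rayleigh fading. Stream 1 is the column with index `0`: only this column of the
deterministic part is nonzero. The rows of the random part are independent (no receive
correlation), and each conjugate-transposed row is `𝒞𝒩(0, R_T)`, where the transmit-correlation
matrix `R_T` is positive definite. -/
structure IsRicianRayleigh {Ω : Type*} [MeasurableSpace Ω] {NR NT : ℕ} [NeZero NT]
    (P : Measure Ω) (K : ℝ) (Hdn : Matrix (Fin NR) (Fin NT) ℂ)
    (RT : Matrix (Fin NT) (Fin NT) ℂ) (Hrn : Ω → Matrix (Fin NR) (Fin NT) ℂ) : Prop where
  K_pos : 0 < K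
  rician : ∃ i, Hdn i 0 ≠ 0
  rayleigh : ∀ i j, j ≠ 0 → Hdn i j = 0
  corr_posDef : RT.PosDef
  rows_indep : iIndepFun (fun (i : Fin NR) (ω : Ω) (j : Fin NT) => star (Hrn ω i j)) P
  rows_law : ∀ i : Fin NR, IsComplexGaussian P (fun ω j => star (Hrn ω i j)) 0 RT

/-- The zero-forcing SNR of stream 1, `γ₁ = Γ_s / [(Hᴴ H)⁻¹]₁₁`; the entry is real. -/
def zfSNR {NR NT : ℕ} [NeZero NT] (Γs : ℝ) (H : Matrix (Fin NR) (Fin NT) ℂ) : ℝ :=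
  Γs / ((Hᴴ * H)⁻¹ 0 0).re

/-- `[R_{T,K}⁻¹]₁₁`, where `R_{T,K} = R_T / (K + 1)`; the entry is real. -/
def invCov11 {NT : ℕ} [NeZero NT] (K : ℝ) (RT : Matrix (Fin NT) (Fin NT) ℂ) : ℝ :=
  ((((1 / (K + 1) : ℝ) : ℂ) • RT)⁻¹ 0 0).re

/-- The scale `Γ₁ = Γ_s / [R_{T,K}⁻¹]₁₁`. -/
def snrScale {NT : ℕ} [NeZero NT] (Γs K : ℝ) (RT : Matrix (Fin NT) (Fin NT) ℂ) : ℝ :=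
  Γs / invCov11 K RT

/-- `a = [R_{T,K}⁻¹]₁₁ ‖h_{d,1}‖²`, where `h_{d,1}` is the first column of
`H_d = √(K/(K+1)) H_dn`. -/
def ricianParam {NR NT : ℕ} [NeZero NT] (K : ℝ) (Hdn : Matrix (Fin NR) (Fin NT) ℂ)
    (RT : Matrix (Fin NT) (Fin NT) ℂ) : ℝ :=
  invCov11 K RT * ∑ i, ‖((Real.sqrt (K / (K + 1)) : ℝ) : ℂ) * Hdn i 0‖ ^ 2

end

/-! Finite expansion: for `N = a + 1`, `NR = a + b + 2`, Kummer's function is a multiple of Euler's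
integral of `exp (z t) t^a (1 - t)^b` over `[0, 1]` (`kummer1F1_eq_integral`). Repeated integration
by parts ends because the weight is a polynomial; the endpoint `0` gives the algebraic part and the
endpoint `1` the factor of the exponential.

Moment generating function: write the inverse of `R_{T,K}` as `L Lᴴ`, where row `0` of `L` is `ρ
e₀`. Then `H L` has independent standard Gaussian columns, except that column `0` is shifted by a
vector `h` with `‖h‖² = a`, and `γ₁` is `Γ₁` times the squared distance of column `0` from the span
of the others (`zfSNR_eq_gramResidual`, `gramResidual_eq_sq_norm`, `map_euclideanCols_mul_eq_pi`).

Given the other columns `Y`, almost surely independent, this distance is the norm of a shifted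
Gaussian vector in a space of complex dimension `N`. With `τ = Γ₁ s`, its transform is `(1 - τ)^(-N)
exp (τ / (1 - τ) ‖Q h‖²)`, where `Q` projects onto the orthogonal complement of the span of `Y`.

It remains to average over `Y`. By unitary invariance the `n`-th moment of `‖Q x‖²` is `c_n
‖x‖^(2n)`. Taking `x` Gaussian as well and exchanging the integrals gives `c_n = (N)_n / (NR)_n`
(`integral_gramResidual_pow`), so the exponential series sums to `₁F₁(N; NR; σ)`. -/

/-! ### Kummer's series with natural parameters -/

theorem ascPochhammer_eval_natCast_eq_ascFactorial {R : Type*} [Semiring R] (N n : ℕ) :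
    (ascPochhammer R n).eval (N : R) = ((N.ascFactorial n : ℕ) : R) := by
  rw [← ascPochhammer_eval_cast, ascPochhammer_nat_eq_ascFactorial]

theorem Nat.ascFactorial_le_ascFactorial {N M : ℕ} (h : N ≤ M) (n : ℕ) :
    N.ascFactorial n ≤ M.ascFactorial n := by
  induction n with
  | zero => simp
  | succ n ih =>
    rw [Nat.ascFactorial_succ, Nat.ascFactorial_succ]
    gcongr

theorem Nat.ascFactorial_pos_of_pos {M : ℕ} (h : 0 < M) (n : ℕ) : 0 < M.ascFactorial n := by
  obtain ⟨m, rfl⟩ := Nat.exists_eq_succ_of_ne_zero h.ne'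
  exact Nat.ascFactorial_pos m n

theorem kummerTerm_natCast {𝕜 : Type*} [RCLike 𝕜] (N M : ℕ) (z : 𝕜) (n : ℕ) :
    kummerTerm (N : 𝕜) (M : 𝕜) z n =
      (N.ascFactorial n : 𝕜) / (M.ascFactorial n : 𝕜) * (z ^ n / (n ! : 𝕜)) := by
  simp only [kummerTerm, ascPochhammer_eval_natCast_eq_ascFactorial]

/-- As `N ≤ M`, the Pochhammer quotient is at most one and the exponential series dominates. -/
theorem summable_kummerTerm_natCast {N M : ℕ} (hM : 0 < M) (h : N ≤ M) (z : ℂ) :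
    Summable (kummerTerm (N : ℂ) (M : ℂ) z) := by
  refine Summable.of_norm_bounded (Real.summable_pow_div_factorial ‖z‖) fun n => ?_
  have hp : (0 : ℝ) < (M.ascFactorial n : ℝ) := by exact_mod_cast Nat.ascFactorial_pos_of_pos hM n
  have hle : (N.ascFactorial n : ℝ) / (M.ascFactorial n : ℝ) ≤ 1 := by
    rw [div_le_one hp]
    exact_mod_cast Nat.ascFactorial_le_ascFactorial h n
  rw [kummerTerm_natCast, norm_mul, norm_div, norm_div, norm_pow]
  simp only [Complex.norm_natCast]
  exact mul_le_of_le_one_left (by positivity) hle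

theorem kummer1F1_natCast_self {M : ℕ} (hM : 0 < M) (z : ℂ) :
    kummer1F1 (M : ℂ) (M : ℂ) z = Complex.exp z := by
  have : kummerTerm (M : ℂ) (M : ℂ) z = fun n => z ^ n / (n ! : ℂ) := by
    funext n
    have hp : (M.ascFactorial n : ℂ) ≠ 0 := by
      exact_mod_cast (Nat.ascFactorial_pos_of_pos hM n).ne'
    rw [kummerTerm_natCast, div_self hp, one_mul]
  rw [kummer1F1, this, Complex.exp_eq_exp_ℂ, NormedSpace.exp_eq_tsum_div]

theorem ofReal_kummer1F1_natCast (N M : ℕ) (x : ℝ) :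
    ((kummer1F1 (N : ℝ) (M : ℝ) x : ℝ) : ℂ) = kummer1F1 (N : ℂ) (M : ℂ) (x : ℂ) := by
  rw [kummer1F1, kummer1F1, Complex.ofReal_tsum]
  congr 1
  funext n
  simp [kummerTerm_natCast]

theorem ofReal_kummerAlgPart (N M : ℕ) (x : ℝ) :
    ((kummerAlgPart N M x : ℝ) : ℂ) = kummerAlgPart N M (x : ℂ) := by
  simp [kummerAlgPart, ascPochhammer_eval_natCast_eq_ascFactorial]

theorem ofReal_kummerExpPart (N M : ℕ) (x : ℝ) :
    ((kummerExpPart N M x : ℝ) : ℂ) = kummerExpPart N M (x : ℂ) := by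
  simp only [kummerExpPart, ascPochhammer_eval_natCast_eq_ascFactorial]
  push_cast
  rfl

/-! ### Euler's integral and the finite expansion -/

theorem integral_pow_mul_one_sub_pow (a b : ℕ) :
    ∫ t in (0 : ℝ)..1, (t : ℂ) ^ a * (1 - (t : ℂ)) ^ b =
      (a ! : ℂ) * (b ! : ℂ) / ((a + b + 1)! : ℂ) := by
  have ha : 0 < ((a : ℂ) + 1).re := by simp; positivity
  have hb : 0 < ((b : ℂ) + 1).re := by simp; positivity
  have h := Complex.Gamma_mul_Gamma_eq_betaIntegral ha hb
  have e : (a : ℂ) + 1 + ((b : ℂ) + 1) = ((a + b + 1 : ℕ) : ℂ) + 1 := by push_cast; ring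
  rw [e, Complex.Gamma_nat_eq_factorial, Complex.Gamma_nat_eq_factorial,
    Complex.Gamma_nat_eq_factorial] at h
  have hne : ((a + b + 1)! : ℂ) ≠ 0 := by exact_mod_cast (Nat.factorial_pos _).ne'
  rw [eq_div_iff hne, h, mul_comm, Complex.betaIntegral]
  simp [Complex.cpow_natCast]

/-- Expand the exponential under the integral, with dominating terms `‖z‖^n / n!`; each term is a
Beta integral whose factorials form the Pochhammer quotient. -/
theorem kummer1F1_eq_integral (a b : ℕ) (z : ℂ) :
    kummer1F1 ((a + 1 : ℕ) : ℂ) ((a + b + 2 : ℕ) : ℂ) z =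
      ((a + b + 1)! : ℂ) / ((a ! : ℂ) * (b ! : ℂ)) *
        ∫ t in (0 : ℝ)..1, Complex.exp (z * t) * ((t : ℂ) ^ a * (1 - (t : ℂ)) ^ b) := by
  have key : HasSum (fun n : ℕ => ∫ t in (0 : ℝ)..1,
      (z * t) ^ n / (n ! : ℂ) * ((t : ℂ) ^ a * (1 - (t : ℂ)) ^ b))
      (∫ t in (0 : ℝ)..1, Complex.exp (z * t) * ((t : ℂ) ^ a * (1 - (t : ℂ)) ^ b)) := by
    refine intervalIntegral.hasSum_integral_of_dominated_convergence
      (fun n _ => ‖z‖ ^ n / (n ! : ℝ)) (fun n => ?_) (fun n => ?_) ?_ ?_ ?_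
    · exact Continuous.aestronglyMeasurable (by fun_prop)
    · refine ae_of_all _ fun t ht => ?_
      rw [Set.uIoc_of_le zero_le_one] at ht
      have h1 : ‖(t : ℂ)‖ ≤ 1 := by
        rw [Complex.norm_real, Real.norm_of_nonneg ht.1.le]; exact ht.2
      have h2 : ‖1 - (t : ℂ)‖ ≤ 1 := by
        rw [← Complex.ofReal_one, ← Complex.ofReal_sub, Complex.norm_real,
          Real.norm_of_nonneg (by linarith [ht.2])]
        linarith [ht.1]
      rw [norm_mul, norm_div, norm_pow, norm_mul, norm_mul, norm_pow, norm_pow,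
        Complex.norm_natCast]
      calc _ ≤ (‖z‖ * 1) ^ n / (n ! : ℝ) * (1 ^ a * 1 ^ b) := by gcongr
        _ = _ := by simp
    · exact ae_of_all _ fun t _ => Real.summable_pow_div_factorial ‖z‖
    · simp
    · refine ae_of_all _ fun t _ => ?_
      have := NormedSpace.expSeries_div_hasSum_exp (z * (t : ℂ))
      rw [← Complex.exp_eq_exp_ℂ] at this
      exact this.mul_right _
  rw [← key.tsum_eq, kummer1F1, ← tsum_mul_left]
  congr 1
  funext n
  have e : ∀ t : ℝ, (z * t) ^ n / (n ! : ℂ) * ((t : ℂ) ^ a * (1 - (t : ℂ)) ^ b) =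
      z ^ n / (n ! : ℂ) * ((t : ℂ) ^ (a + n) * (1 - (t : ℂ)) ^ b) := fun t => by
    rw [mul_pow, pow_add]; ring
  simp only [e]
  rw [intervalIntegral.integral_const_mul, integral_pow_mul_one_sub_pow, kummerTerm_natCast]
  have h1 := Nat.factorial_mul_ascFactorial a n
  have h2 := Nat.factorial_mul_ascFactorial (a + b + 1) n
  have e2 : a + n + b + 1 = a + b + 1 + n := by ring
  rw [e2, ← h1, ← h2]
  have g1 : ((a + b + 1)! : ℂ) ≠ 0 := by exact_mod_cast (Nat.factorial_pos _).ne'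
  have g2 : (a ! : ℂ) ≠ 0 := by exact_mod_cast (Nat.factorial_pos _).ne'
  have g3 : (b ! : ℂ) ≠ 0 := by exact_mod_cast (Nat.factorial_pos _).ne'
  have g4 : ((a + b + 1 + 1).ascFactorial n : ℂ) ≠ 0 := by
    exact_mod_cast (Nat.ascFactorial_pos _ n).ne'
  have g5 : (n ! : ℂ) ≠ 0 := by exact_mod_cast (Nat.factorial_pos _).ne'
  push_cast
  have e3 : a + b + 2 = a + b + 1 + 1 := rfl
  rw [e3]
  field_simp

/-- Repeated integration by parts of `exp (z t) P(t)` for a polynomial `P`. -/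
theorem integral_exp_mul_polynomial {z : ℂ} (hz : z ≠ 0) (P : Polynomial ℂ) {n : ℕ}
    (hn : P.natDegree < n) :
    ∫ t in (0 : ℝ)..1, Complex.exp (z * t) * P.eval (t : ℂ) =
      Complex.exp z * (∑ j ∈ Finset.range n,
        (-1) ^ j * (j ! : ℂ) * (Polynomial.taylor 1 P).coeff j * (z⁻¹) ^ (j + 1)) -
      ∑ j ∈ Finset.range n, (-1) ^ j * (j ! : ℂ) * P.coeff j * (z⁻¹) ^ (j + 1) := by
  set D : ℕ → Polynomial ℂ := fun j => Polynomial.derivative^[j] P with hD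
  -- `S` is the polynomial solution of `z S + S' = P`, so `exp (z t) S(t)` is an antiderivative of
  -- the integrand. The sum telescopes because the `n`-th derivative of `P` vanishes.
  set S : Polynomial ℂ :=
    ∑ j ∈ Finset.range n, Polynomial.C ((-1) ^ j * (z⁻¹) ^ (j + 1)) * D j with hS
  have hDn : D n = 0 := Polynomial.iterate_derivative_eq_zero hn
  have hS' : Polynomial.C z * S + Polynomial.derivative S = P := by
    have hstep : ∀ j, Polynomial.C z * (Polynomial.C ((-1) ^ j * (z⁻¹) ^ (j + 1)) * D j) +
        Polynomial.derivative (Polynomial.C ((-1) ^ j * (z⁻¹) ^ (j + 1)) * D j) =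
        Polynomial.C ((-1) ^ j * (z⁻¹) ^ j) * D j -
          Polynomial.C ((-1) ^ (j + 1) * (z⁻¹) ^ (j + 1)) * D (j + 1) := by
      intro j
      have h1 : Polynomial.derivative (D j) = D (j + 1) := by
        simp only [hD, Function.iterate_succ_apply']
      have h2 : z * ((-1) ^ j * (z⁻¹) ^ (j + 1)) = (-1) ^ j * (z⁻¹) ^ j := by
        rw [pow_succ]; field_simp
      rw [Polynomial.derivative_C_mul, h1, ← mul_assoc, ← Polynomial.C_mul, h2, pow_succ (-1 : ℂ)]
      simp
    rw [hS, Finset.mul_sum, Polynomial.derivative_sum, ← Finset.sum_add_distrib,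
      Finset.sum_congr rfl fun j _ => hstep j, Finset.sum_range_sub', hDn]
    simp [hD]
  have hSe : ∀ r : ℂ, S.eval r = ∑ j ∈ Finset.range n,
      (-1) ^ j * (j ! : ℂ) * (Polynomial.taylor r P).coeff j * (z⁻¹) ^ (j + 1) := by
    intro r
    rw [hS, Polynomial.eval_finsetSum]
    refine Finset.sum_congr rfl fun j _ => ?_
    have : D j = (j ! : ℂ) • Polynomial.hasseDeriv j P := by
      simp only [hD, ← Polynomial.factorial_smul_hasseDeriv, Nat.cast_smul_eq_nsmul]
      rfl
    rw [Polynomial.eval_C_mul, this, Polynomial.eval_smul, Polynomial.taylor_coeff, smul_eq_mul]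
    ring
  have hderiv : ∀ t ∈ Set.uIcc (0 : ℝ) 1, HasDerivAt
      (fun t : ℝ => Complex.exp (z * t) * S.eval (t : ℂ)) (Complex.exp (z * t) * P.eval (t : ℂ)) t := by
    intro t _
    have h : HasDerivAt (fun w : ℂ => Complex.exp (z * w) * S.eval w)
        (Complex.exp (z * t) * P.eval (t : ℂ)) (t : ℂ) := by
      have h1 : HasDerivAt (fun w : ℂ => Complex.exp (z * w)) (Complex.exp (z * t) * z) (t : ℂ) := by
        simpa using ((hasDerivAt_id (t : ℂ)).const_mul z).cexp
      have h2 := h1.mul (S.hasDerivAt (t : ℂ))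
      have h3 : P.eval (t : ℂ) = z * S.eval (t : ℂ) + (Polynomial.derivative S).eval (t : ℂ) := by
        conv_lhs => rw [← hS']
        simp
      rw [h3, mul_add, ← mul_assoc]
      exact h2
    exact h.comp_ofReal
  rw [intervalIntegral.integral_eq_sub_of_hasDerivAt hderiv
    (Continuous.intervalIntegrable (by fun_prop) _ _)]
  simp [hSe]

theorem coeff_X_pow_mul_one_sub_X_pow (a b k : ℕ) :
    (Polynomial.X ^ a * (1 - Polynomial.X) ^ b : Polynomial ℂ).coeff (a + k) =
      (-1) ^ k * (b.choose k : ℂ) := by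
  have : (1 - Polynomial.X : Polynomial ℂ) ^ b =
      ((1 + Polynomial.X) ^ b).comp (Polynomial.C (-1) * Polynomial.X) := by
    simp [sub_eq_add_neg]
  rw [add_comm a k, Polynomial.coeff_X_pow_mul, this, Polynomial.comp_C_mul_X_coeff,
    Polynomial.coeff_one_add_X_pow, mul_comm]

theorem kummer1F1_finite_expansion (a b : ℕ) {z : ℂ} (hz : z ≠ 0) :
    kummer1F1 ((a + 1 : ℕ) : ℂ) ((a + b + 2 : ℕ) : ℂ) z =
      kummerAlgPart (a + 1) (a + b + 2) z + Complex.exp z * kummerExpPart (a + 1) (a + b + 2) z := by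
  set P : Polynomial ℂ := Polynomial.X ^ a * (1 - Polynomial.X) ^ b with hP
  have hdeg : P.natDegree < a + (b + 1) := by
    have h1 : (1 - Polynomial.X : Polynomial ℂ).natDegree ≤ 1 := by
      compute_degree
    have h2 : P.natDegree ≤ a + b := by
      refine Polynomial.natDegree_mul_le.trans ?_
      rw [Polynomial.natDegree_X_pow]
      have := Polynomial.natDegree_pow_le_of_le b h1
      omega
    omega
  -- Recentring at `1` exchanges the roles of `a` and `b`: the zero there has order `b`.
  have hT : Polynomial.taylor 1 P = Polynomial.X ^ b * ((-1) ^ b * (1 + Polynomial.X) ^ a) := by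
    rw [hP, Polynomial.taylor_mul, Polynomial.taylor_pow, Polynomial.taylor_pow, map_sub,
      Polynomial.taylor_X, Polynomial.taylor_one]
    simp only [map_one, add_comm]
    rw [sub_add_cancel_left, neg_pow]
    ring
  have hint := integral_exp_mul_polynomial hz P hdeg
  have e1 : ∀ t : ℝ, P.eval (t : ℂ) = (t : ℂ) ^ a * (1 - (t : ℂ)) ^ b := fun t => by simp [hP]
  simp only [e1] at hint
  -- The zero of order `a` at `0` removes the first `a` terms, leaving `b + 1` of them.
  have s1 : ∑ j ∈ Finset.range (a + (b + 1)), (-1) ^ j * (j ! : ℂ) * P.coeff j * (z⁻¹) ^ (j + 1) =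
      ∑ k ∈ Finset.range (b + 1), (-1) ^ a * ((a + k)! : ℂ) * (b.choose k : ℂ) *
        (z⁻¹) ^ (a + 1 + k) := by
    rw [Finset.sum_range_add, Finset.sum_eq_zero, zero_add]
    · refine Finset.sum_congr rfl fun k _ => ?_
      rw [hP, coeff_X_pow_mul_one_sub_X_pow, add_right_comm, pow_add]
      have : ((-1 : ℂ) ^ k) * (-1) ^ k = 1 := by rw [← mul_pow]; simp
      linear_combination (-1) ^ a * ((a + k)! : ℂ) * (b.choose k : ℂ) *
        (z⁻¹) ^ (a + 1 + k) * this
    · intro j hj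
      rw [hP, Polynomial.coeff_X_pow_mul', if_neg (by simpa using hj)]
      simp
  have s2 : ∑ j ∈ Finset.range (a + (b + 1)),
      (-1) ^ j * (j ! : ℂ) * (Polynomial.taylor 1 P).coeff j * (z⁻¹) ^ (j + 1) =
      ∑ k ∈ Finset.range (a + 1), (-1) ^ k * ((b + k)! : ℂ) * (a.choose k : ℂ) *
        (z⁻¹) ^ (b + 1 + k) := by
    rw [show a + (b + 1) = b + (a + 1) by ring, Finset.sum_range_add, Finset.sum_eq_zero, zero_add]
    · refine Finset.sum_congr rfl fun k _ => ?_
      have hc : ((-1) ^ b * (1 + Polynomial.X) ^ a : Polynomial ℂ).coeff k =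
          (-1) ^ b * (a.choose k : ℂ) := by
        rw [show ((-1) ^ b : Polynomial ℂ) = Polynomial.C ((-1) ^ b) by simp,
          Polynomial.coeff_C_mul, Polynomial.coeff_one_add_X_pow]
      rw [hT, add_comm b k, Polynomial.coeff_X_pow_mul, hc, add_comm k b, add_right_comm, pow_add]
      have : ((-1 : ℂ) ^ b) * (-1) ^ b = 1 := by rw [← mul_pow]; simp
      linear_combination (-1) ^ k * ((b + k)! : ℂ) * (a.choose k : ℂ) *
        (z⁻¹) ^ (b + 1 + k) * this
    · intro j hj
      rw [hT, Polynomial.coeff_X_pow_mul', if_neg (by simpa using hj)]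
      simp
  rw [s1, s2] at hint
  rw [kummer1F1_eq_integral, hint, kummerAlgPart, kummerExpPart,
    show a + b + 2 - (a + 1) = b + 1 by omega, show a + b + 2 - 1 = a + b + 1 by omega,
    show b + 1 - 1 = b by omega, show a + 1 - 1 = a by omega]
  have g2 : (a ! : ℂ) ≠ 0 := by exact_mod_cast (Nat.factorial_pos _).ne'
  have g3 : (b ! : ℂ) ≠ 0 := by exact_mod_cast (Nat.factorial_pos _).ne'
  rw [mul_sub, sub_eq_neg_add]
  congr 1
  · rw [Finset.mul_sum, Finset.mul_sum, ← Finset.sum_neg_distrib]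
    refine Finset.sum_congr rfl fun k _ => ?_
    rw [ascPochhammer_eval_natCast_eq_ascFactorial, ← Nat.factorial_mul_ascFactorial a k]
    push_cast
    field_simp
    ring
  · rw [mul_left_comm]
    congr 1
    rw [Finset.mul_sum, Finset.mul_sum]
    refine Finset.sum_congr rfl fun k _ => ?_
    rw [ascPochhammer_eval_natCast_eq_ascFactorial, ← Nat.factorial_mul_ascFactorial b k,
      ← neg_inv, neg_pow z⁻¹, pow_add (-1 : ℂ) (b + 1) k]
    have : ((-1 : ℂ) ^ (b + 1)) * (-1) ^ (b + 1) = 1 := by rw [← mul_pow]; simp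
    push_cast
    field_simp
    linear_combination (-(a.choose k : ℂ)) * this

/-! ### Gaussian integrals on a real Euclidean space -/

section Gaussian

variable {V : Type*} [NormedAddCommGroup V] [InnerProductSpace ℝ V]

/-- The density `π^(-d/2) exp (-‖v‖²)`. -/
noncomputable def halfGaussianDensity (v : V) : ℝ :=
  (Real.pi ^ (Module.finrank ℝ V / 2 : ℝ))⁻¹ * Real.exp (-‖v‖ ^ 2)

theorem halfGaussianDensity_nonneg (v : V) : 0 ≤ halfGaussianDensity v := by
  unfold halfGaussianDensity; positivity

/-- Expanding the square turns the shift into a linear term, so the centred transform covers the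
noncentral case. -/
theorem exp_sq_norm_add_eq (τ : ℝ) (h v : V) :
    ((Real.exp (τ * ‖v + h‖ ^ 2) : ℝ) : ℂ) = ((Real.exp (τ * ‖h‖ ^ 2) : ℝ) : ℂ) *
      Complex.exp ((τ : ℂ) * (‖v‖ : ℂ) ^ 2 + ((2 * τ : ℝ) : ℂ) * (inner ℝ h v : ℂ)) := by
  rw [norm_add_sq_real, real_inner_comm]
  push_cast
  rw [← Complex.exp_add]
  ring_nf

variable [MeasurableSpace V] [BorelSpace V]

theorem measurable_halfGaussianDensity : Measurable (halfGaussianDensity (V := V)) := by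
  unfold halfGaussianDensity; fun_prop

variable [FiniteDimensional ℝ V]

variable (V) in
/-- The centred Gaussian measure on a Euclidean space with covariance `1/2`. -/
noncomputable def halfGaussian : Measure V :=
  volume.withDensity fun v => ENNReal.ofReal (halfGaussianDensity v)

theorem halfGaussian_absolutelyContinuous : halfGaussian V ≪ volume :=
  withDensity_absolutelyContinuous _ _

theorem integral_halfGaussian {F : Type*} [NormedAddCommGroup F] [NormedSpace ℝ F] (f : V → F) :
    ∫ v, f v ∂(halfGaussian V) = ∫ v, halfGaussianDensity v • f v := by
  rw [halfGaussian, integral_withDensity_eq_integral_toReal_smul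
    measurable_halfGaussianDensity.ennreal_ofReal (ae_of_all _ fun _ => ENNReal.ofReal_lt_top)]
  simp [ENNReal.toReal_ofReal (halfGaussianDensity_nonneg _)]

theorem integrable_halfGaussian_iff {F : Type*} [NormedAddCommGroup F] [NormedSpace ℝ F]
    {f : V → F} :
    Integrable f (halfGaussian V) ↔ Integrable fun v => halfGaussianDensity v • f v := by
  rw [halfGaussian, integrable_withDensity_iff_integrable_smul'
    measurable_halfGaussianDensity.ennreal_ofReal (ae_of_all _ fun _ => ENNReal.ofReal_lt_top)]
  simp [ENNReal.toReal_ofReal (halfGaussianDensity_nonneg _)]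

/-- The Laplace transform of `‖·‖²` jointly with a linear form, under `halfGaussian`. -/
theorem integrable_cexp_halfGaussian {τ : ℝ} (hτ : τ < 1) (c : ℂ) (w : V) :
    Integrable (fun v => Complex.exp ((τ : ℂ) * (‖v‖ : ℂ) ^ 2 + c * (inner ℝ w v : ℂ)))
      (halfGaussian V) := by
  have hb : 0 < ((1 - τ : ℝ) : ℂ).re := by simpa using hτ
  rw [integrable_halfGaussian_iff]
  refine ((GaussianFourier.integrable_cexp_neg_mul_sq_norm_add hb c w).const_mul
    (((Real.pi ^ (Module.finrank ℝ V / 2 : ℝ))⁻¹ : ℝ) : ℂ)).congr (ae_of_all _ fun v => ?_)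
  simp only [halfGaussianDensity, Complex.real_smul]
  push_cast
  rw [mul_assoc, ← Complex.exp_add]
  ring_nf

theorem integral_cexp_halfGaussian {τ : ℝ} (hτ : τ < 1) (c : ℂ) (w : V) :
    ∫ v, Complex.exp ((τ : ℂ) * (‖v‖ : ℂ) ^ 2 + c * (inner ℝ w v : ℂ)) ∂(halfGaussian V) =
      (((1 - τ) ^ (-(Module.finrank ℝ V / 2 : ℝ)) : ℝ) : ℂ) *
        Complex.exp (c ^ 2 * (‖w‖ : ℂ) ^ 2 / (4 * (1 - τ))) := by
  -- The density contributes `-‖v‖²`, so the quadratic coefficient is `1 - τ`.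
  have hb : 0 < ((1 - τ : ℝ) : ℂ).re := by simpa using hτ
  have h1 : 0 < 1 - τ := by linarith
  have h := GaussianFourier.integral_cexp_neg_mul_sq_norm_add hb c w
  have e : ∀ v : V, halfGaussianDensity v •
      Complex.exp ((τ : ℂ) * (‖v‖ : ℂ) ^ 2 + c * (inner ℝ w v : ℂ)) =
      (((Real.pi ^ (Module.finrank ℝ V / 2 : ℝ))⁻¹ : ℝ) : ℂ) *
        Complex.exp (-((1 - τ : ℝ) : ℂ) * (‖v‖ : ℂ) ^ 2 + c * (inner ℝ w v : ℂ)) := fun v => by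
    simp only [halfGaussianDensity, Complex.real_smul]
    push_cast
    rw [mul_assoc, ← Complex.exp_add]
    ring_nf
  rw [integral_halfGaussian]
  simp only [e]
  rw [integral_const_mul, h, ← mul_assoc]
  congr 1
  · have e2 : ((Real.pi : ℂ) / ((1 - τ : ℝ) : ℂ)) ^ ((Module.finrank ℝ V : ℂ) / 2) =
        (((Real.pi / (1 - τ)) ^ (Module.finrank ℝ V / 2 : ℝ) : ℝ) : ℂ) := by
      rw [Complex.ofReal_cpow (by positivity)]
      push_cast
      rfl
    rw [e2, ← Complex.ofReal_mul]
    congr 1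
    rw [Real.div_rpow Real.pi_pos.le h1.le, Real.rpow_neg h1.le]
    field_simp
  · push_cast
    rfl

instance isProbabilityMeasure_halfGaussian : IsProbabilityMeasure (halfGaussian V) := by
  have h := integral_cexp_halfGaussian (V := V) zero_lt_one 0 0
  have hi := integrable_cexp_halfGaussian (V := V) zero_lt_one 0 0
  simp only [Complex.ofReal_zero, zero_mul, add_zero, Complex.exp_zero] at h hi
  have : IsFiniteMeasure (halfGaussian V) := by
    rw [integrable_const_iff] at hi
    simpa using hi
  rw [integral_const] at h
  have h' : (halfGaussian V).real Set.univ = 1 := by simpa using h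
  rw [measureReal_def, ENNReal.toReal_eq_one_iff] at h'
  exact ⟨h'⟩

/-- The divisor `4` matches that of `IsComplexGaussian` with identity covariance. -/
theorem charFun_halfGaussian (t : V) :
    charFun (halfGaussian V) t = Complex.exp (-(‖t‖ : ℂ) ^ 2 / 4) := by
  have h := integral_cexp_halfGaussian (V := V) zero_lt_one Complex.I t
  simp at h
  rw [charFun_apply]
  simp only [mul_comm, real_inner_comm] at h ⊢
  rw [h]

/-- Orthogonal projections, and more generally co-isometries, preserve `halfGaussian`. -/
theorem map_halfGaussian {V' : Type*} [NormedAddCommGroup V'] [InnerProductSpace ℝ V']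
    [FiniteDimensional ℝ V'] [MeasurableSpace V'] [BorelSpace V'] (f : V → V') (g : V' → V)
    (hf : Continuous f) (hfg : ∀ x t, inner ℝ (f x) t = inner ℝ x (g t))
    (hg : ∀ t, ‖g t‖ = ‖t‖) : (halfGaussian V).map f = halfGaussian V' := by
  have : IsProbabilityMeasure ((halfGaussian V).map f) :=
    Measure.isProbabilityMeasure_map hf.aemeasurable
  -- The image has at `t` the characteristic function of the source at `g t`, which depends only on
  -- the norm.
  refine Measure.ext_of_charFun (funext fun t => ?_)
  rw [charFun_halfGaussian, charFun_apply, integral_map hf.aemeasurable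
    (Continuous.aestronglyMeasurable (by fun_prop))]
  simp only [hfg]
  rw [← charFun_apply, charFun_halfGaussian, hg]

theorem map_orthogonalProjection_halfGaussian (W : Submodule ℝ V) :
    (halfGaussian V).map W.orthogonalProjectionOnto = halfGaussian W := by
  refine map_halfGaussian _ (fun w : W => (w : V)) (by fun_prop) (fun x t => ?_) (fun t => rfl)
  exact Submodule.inner_orthogonalProjectionOnto_eq_of_mem_right t x

theorem integrable_exp_sq_norm_add {τ : ℝ} (hτ : τ < 1) (h : V) :
    Integrable (fun v => Real.exp (τ * ‖v + h‖ ^ 2)) (halfGaussian V) := by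
  have := ((integrable_cexp_halfGaussian hτ (2 * τ : ℝ) h).const_mul
    ((Real.exp (τ * ‖h‖ ^ 2) : ℝ) : ℂ)).re
  simp only [← exp_sq_norm_add_eq] at this
  exact this

theorem integral_exp_sq_norm_add {τ : ℝ} (hτ : τ < 1) (h : V) :
    ∫ v, Real.exp (τ * ‖v + h‖ ^ 2) ∂(halfGaussian V) =
      (1 - τ) ^ (-(Module.finrank ℝ V / 2 : ℝ)) * Real.exp (τ * ‖h‖ ^ 2 / (1 - τ)) := by
  rw [← Complex.ofReal_inj, ← integral_complex_ofReal]
  simp only [exp_sq_norm_add_eq]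
  rw [integral_const_mul, integral_cexp_halfGaussian hτ, mul_left_comm]
  push_cast
  rw [← Complex.exp_add]
  have : (1 - (τ : ℂ)) ≠ 0 := by
    rw [← Complex.ofReal_one, ← Complex.ofReal_sub, Complex.ofReal_ne_zero]
    linarith
  congr 2
  field_simp
  ring

theorem integrable_exp_sq_norm_orthogonalProjection_add (W : Submodule ℝ V) {τ : ℝ} (hτ : τ < 1)
    (h : V) :
    Integrable (fun v => Real.exp (τ * ‖W.orthogonalProjectionOnto (v + h)‖ ^ 2))
      (halfGaussian V) := by
  have := integrable_exp_sq_norm_add hτ (W.orthogonalProjectionOnto h)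
  rw [← map_orthogonalProjection_halfGaussian W] at this
  simpa [Function.comp_def] using this.comp_aemeasurable (by fun_prop)

/-- The projected measure is again `halfGaussian`. The even dimension, that of a complex subspace,
makes the exponent an integer. -/
theorem integral_exp_sq_norm_orthogonalProjection_add (W : Submodule ℝ V) {τ : ℝ} (hτ : τ < 1)
    (h : V) {p : ℕ} (hp : Module.finrank ℝ W = 2 * p) :
    ∫ v, Real.exp (τ * ‖W.orthogonalProjectionOnto (v + h)‖ ^ 2) ∂(halfGaussian V) =
      1 / (1 - τ) ^ p * Real.exp (τ * ‖W.orthogonalProjectionOnto h‖ ^ 2 / (1 - τ)) := by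
  have := integral_exp_sq_norm_add hτ (W.orthogonalProjectionOnto h)
  rw [← map_orthogonalProjection_halfGaussian W, integral_map (by fun_prop)
    (Continuous.aestronglyMeasurable (by fun_prop)), hp] at this
  simp only [map_add]
  rw [this]
  push_cast
  rw [mul_div_cancel_left₀ _ (two_ne_zero' ℝ), Real.rpow_neg (by linarith), Real.rpow_natCast,
    one_div]

variable {p : ℕ}

theorem mem_interior_integrableExpSet_sq_norm {t : ℝ} (ht : t < 1) :
    t ∈ interior (integrableExpSet (fun v : V => ‖v‖ ^ 2) (halfGaussian V)) := by
  refine mem_interior.mpr ⟨Set.Iio 1, fun u hu => ?_, isOpen_Iio, ht⟩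
  simpa [integrableExpSet] using integrable_exp_sq_norm_add (V := V) hu 0

theorem mgf_sq_norm_halfGaussian (hp : Module.finrank ℝ V = 2 * p) {t : ℝ} (ht : t < 1) :
    mgf (fun v : V => ‖v‖ ^ 2) (halfGaussian V) t = ((1 - t) ^ p)⁻¹ := by
  have := integral_exp_sq_norm_add (V := V) ht 0
  rw [mgf]
  simp only [add_zero] at this
  rw [this, hp]
  push_cast
  rw [mul_div_cancel_left₀ _ (two_ne_zero' ℝ), Real.rpow_neg (by linarith), Real.rpow_natCast]
  simp

theorem iteratedDeriv_mgf_sq_norm_halfGaussian (hp : Module.finrank ℝ V = 2 * p) (n : ℕ) {t : ℝ}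
    (ht : t < 1) :
    iteratedDeriv n (mgf (fun v : V => ‖v‖ ^ 2) (halfGaussian V)) t =
      p.ascFactorial n * ((1 - t) ^ (p + n))⁻¹ := by
  induction n generalizing t with
  | zero => simpa using mgf_sq_norm_halfGaussian hp ht
  | succ n ih =>
    have h1 : 1 - t ≠ 0 := by linarith
    have hev : iteratedDeriv n (mgf (fun v : V => ‖v‖ ^ 2) (halfGaussian V)) =ᶠ[nhds t]
        fun t => p.ascFactorial n * ((1 - t) ^ (p + n))⁻¹ :=
      Filter.eventually_of_mem (isOpen_Iio.mem_nhds ht) fun u hu => ih hu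
    have hd := ((((hasDerivAt_id t).const_sub 1).pow (p + n)).inv (pow_ne_zero _ h1)).const_mul
      (p.ascFactorial n : ℝ)
    rw [iteratedDeriv_succ, hev.deriv_eq]
    refine hd.deriv.trans ?_
    rw [Nat.ascFactorial_succ]
    simp only [id, Pi.pow_apply]
    push_cast
    -- The derivative of the power involves the exponent `p + n - 1`, so the constant case is
    -- separate.
    rcases Nat.eq_zero_or_pos (p + n) with h0 | h0
    · obtain ⟨rfl, rfl⟩ : p = 0 ∧ n = 0 := by omega
      simp
    · obtain ⟨k, hk⟩ := Nat.exists_eq_succ_of_ne_zero h0.ne'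
      have hk' : (p : ℝ) + n = k + 1 := by exact_mod_cast hk
      rw [show p + (n + 1) = k + 2 by omega, hk, hk']
      simp
      field_simp
      ring

/-- The moments are the derivatives at `0` of the generating function `(1 - t)^(-p)`. -/
theorem integral_sq_norm_pow_halfGaussian (hp : Module.finrank ℝ V = 2 * p) (n : ℕ) :
    ∫ v, (‖v‖ ^ 2) ^ n ∂(halfGaussian V) = p.ascFactorial n := by
  have h := iteratedDeriv_mgf_zero (mem_interior_integrableExpSet_sq_norm (V := V) zero_lt_one) n
  rw [iteratedDeriv_mgf_sq_norm_halfGaussian hp n zero_lt_one] at h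
  simpa using h.symm

theorem integrable_sq_norm_pow_halfGaussian (n : ℕ) :
    Integrable (fun v : V => (‖v‖ ^ 2) ^ n) (halfGaussian V) :=
  integrable_pow_of_mem_interior_integrableExpSet
    (mem_interior_integrableExpSet_sq_norm (V := V) zero_lt_one) n

theorem integral_sq_norm_orthogonalProjection_pow (W : Submodule ℝ V)
    (hp : Module.finrank ℝ W = 2 * p) (n : ℕ) :
    ∫ v, (‖W.orthogonalProjectionOnto v‖ ^ 2) ^ n ∂(halfGaussian V) = p.ascFactorial n := by
  have := integral_sq_norm_pow_halfGaussian hp n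
  rwa [← map_orthogonalProjection_halfGaussian W, integral_map (by fun_prop)
    (Continuous.aestronglyMeasurable (by fun_prop))] at this

end Gaussian

/-! ### Gram matrices, distances to spans and generic independence -/

section ComplexColumns

variable {ι : Type*} [Fintype ι] {m : ℕ}

theorem EuclideanSpace.real_inner_eq_re_inner (x y : EuclideanSpace ℂ ι) :
    inner ℝ x y = (inner ℂ x y).re := by
  simp [PiLp.inner_apply, Complex.inner]

/-- The orthogonal complement of the complex span of a family, as a real subspace. -/
noncomputable def orthSpan {κ : Type*} (Y : κ → EuclideanSpace ℂ ι) :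
    Submodule ℝ (EuclideanSpace ℂ ι) :=
  ((Submodule.span ℂ (Set.range Y))ᗮ).restrictScalars ℝ

theorem mem_orthSpan {κ : Type*} {Y : κ → EuclideanSpace ℂ ι} {x : EuclideanSpace ℂ ι} :
    x ∈ orthSpan Y ↔ ∀ j, inner ℂ (Y j) x = 0 := by
  rw [orthSpan, Submodule.restrictScalars_mem, Submodule.mem_orthogonal]
  refine ⟨fun h j => h _ (Submodule.subset_span ⟨j, rfl⟩), fun h u hu => ?_⟩
  induction hu using Submodule.span_induction with
  | mem u hu => obtain ⟨j, rfl⟩ := hu; exact h j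
  | zero => simp
  | add u v _ _ hu hv => rw [inner_add_left, hu, hv, add_zero]
  | smul c u _ hu => rw [inner_smul_left, hu, mul_zero]

theorem orthogonalProjectionOnto_orthSpan_eq_zero {κ : Type*} {Y : κ → EuclideanSpace ℂ ι}
    {x : EuclideanSpace ℂ ι} (hx : x ∈ Submodule.span ℂ (Set.range Y)) :
    (orthSpan Y).orthogonalProjectionOnto x = 0 := by
  rw [Submodule.orthogonalProjectionOnto_eq_zero_iff, Submodule.mem_orthogonal]
  intro u hu
  rw [EuclideanSpace.real_inner_eq_re_inner,
    Submodule.inner_left_of_mem_orthogonal (K := Submodule.span ℂ (Set.range Y)) hx hu]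
  rfl

theorem finrank_orthSpan {Y : Fin m → EuclideanSpace ℂ ι} (hY : LinearIndependent ℂ Y) :
    Module.finrank ℝ (orthSpan Y) = 2 * (Fintype.card ι - m) := by
  have h1 : Module.finrank ℝ (orthSpan Y) =
      2 * Module.finrank ℂ ((Submodule.span ℂ (Set.range Y))ᗮ : Submodule ℂ _) :=
    finrank_real_of_complex ((Submodule.span ℂ (Set.range Y))ᗮ : Submodule ℂ _)
  have h2 := (Submodule.span ℂ (Set.range Y)).finrank_add_finrank_orthogonal
  rw [finrank_span_eq_card hY, finrank_euclideanSpace, Fintype.card_fin] at h2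
  rw [h1]
  omega

/-- The squared distance of the first vector of a family from the span of the others, computed
from the Gram matrix. -/
noncomputable def gramResidual (v : Fin (m + 1) → EuclideanSpace ℂ ι) : ℝ :=
  1 / ((gram ℂ v)⁻¹ 0 0).re

/-- Column `0` of the inverse Gram matrix gives the coefficients `c` of the vector `w` dual to `v
0`. Orthogonality to the other vectors makes `w` equal to `c 0` times the projection of `v 0`, while
duality gives `‖w‖² = c 0`; comparing the two yields the claim. -/
theorem gramResidual_eq_sq_norm {v : Fin (m + 1) → EuclideanSpace ℂ ι}
    (hv : LinearIndependent ℂ (Fin.tail v)) :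
    gramResidual v = ‖(orthSpan (Fin.tail v)).orthogonalProjectionOnto (v 0)‖ ^ 2 := by
  set W := orthSpan (Fin.tail v) with hW
  -- In the singular case the inverse is `0` by convention and the residual is `1 / 0 = 0`, which is
  -- right since `v 0` lies in the span of the tail.
  by_cases hdet : (gram ℂ v).det = 0
  · have hz : (gram ℂ v)⁻¹ = 0 := Matrix.nonsing_inv_apply_not_isUnit _ (by simp [hdet])
    have hnli : ¬ LinearIndependent ℂ v := by
      rw [← det_gram_ne_zero_iff_linearIndependent]; simpa using hdet
    rw [linearIndependent_finSucc] at hnli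
    have hmem : v 0 ∈ Submodule.span ℂ (Set.range (Fin.tail v)) := by
      by_contra hc; exact hnli ⟨hv, hc⟩
    rw [gramResidual, hz, orthogonalProjectionOnto_orthSpan_eq_zero hmem]
    simp
  · have hu : IsUnit (gram ℂ v).det := isUnit_iff_ne_zero.mpr hdet
    set c : Fin (m + 1) → ℂ := fun j => (gram ℂ v)⁻¹ j 0 with hc
    have hGc : gram ℂ v *ᵥ c = Pi.single 0 1 := by
      funext i
      have := congrFun (congrFun (Matrix.mul_nonsing_inv _ hu) i) 0
      rw [Matrix.mul_apply] at this
      simp only [mulVec, dotProduct, hc, this, Matrix.one_apply, Pi.single_apply]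
    set w := ∑ i, c i • v i with hw
    have hin : ∀ j, inner ℂ (v j) w = (Pi.single 0 1 : Fin (m + 1) → ℂ) j := by
      intro j
      rw [← hGc, hw, inner_sum]
      simp [mulVec, dotProduct, inner_smul_right, mul_comm]
    have hww : (c 0).re = ‖w‖ ^ 2 ∧ (c 0).im = 0 := by
      have h1 : (starRingEnd ℂ) (c 0) = ((‖w‖ ^ 2 : ℝ) : ℂ) := by
        have := inner_self_eq_norm_sq_to_K (𝕜 := ℂ) w
        conv_lhs at this => rw [hw, sum_inner]
        simp only [inner_smul_left, ← hw, hin] at this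
        rw [Finset.sum_eq_single 0 (by simp +contextual) (by simp)] at this
        simpa using this
      have h2 := congrArg Complex.re h1
      have h3 := congrArg Complex.im h1
      simp only [Complex.conj_re, Complex.conj_im, Complex.ofReal_re, Complex.ofReal_im] at h2 h3
      exact ⟨h2, by linarith⟩
    have hwW : w ∈ W := mem_orthSpan.mpr fun j => by
      simpa [Fin.tail] using hin j.succ
    have hc0 : c 0 = (((c 0).re : ℝ) : ℂ) := Complex.ext rfl (by simp [hww.2])
    have hproj : w = (((c 0).re • W.orthogonalProjectionOnto (v 0) : W) : EuclideanSpace ℂ ι) := by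
      have h1 : W.orthogonalProjectionOnto w = (c 0).re • W.orthogonalProjectionOnto (v 0) := by
        have hmem : (∑ i : Fin m, c i.succ • v i.succ) ∈
            Submodule.span ℂ (Set.range (Fin.tail v)) :=
          Submodule.sum_mem _ fun i _ => Submodule.smul_mem _ _ (Submodule.subset_span ⟨i, rfl⟩)
        rw [hw, Fin.sum_univ_succ, map_add, orthogonalProjectionOnto_orthSpan_eq_zero hmem,
          add_zero, hc0, Complex.coe_smul, map_smul, Complex.ofReal_re]
      rw [← h1, Submodule.orthogonalProjectionOnto_mem_subspace_eq_self (⟨w, hwW⟩ : W)]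
    have hnorm : ‖w‖ ^ 2 = (c 0).re ^ 2 * ‖W.orthogonalProjectionOnto (v 0)‖ ^ 2 := by
      conv_lhs => rw [hproj]
      rw [← Submodule.coe_norm, norm_smul, mul_pow, Real.norm_eq_abs, sq_abs]
    have hne : (c 0).re ≠ 0 := by
      intro h0
      have : w = 0 := by rw [hproj, h0]; simp
      have h1 := hin 0
      rw [this] at h1
      simp at h1
    have : gramResidual v = 1 / (c 0).re := rfl
    rw [this, div_eq_iff hne]
    rw [← hww.1] at hnorm
    have : (c 0).re * (1 - (c 0).re * ‖W.orthogonalProjectionOnto (v 0)‖ ^ 2) = 0 := by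
      linear_combination hnorm
    rcases mul_eq_zero.mp this with h | h
    · exact absurd h hne
    · linear_combination h

theorem gramResidual_linearIsometryEquiv (U : EuclideanSpace ℂ ι ≃ₗᵢ[ℂ] EuclideanSpace ℂ ι)
    (v : Fin (m + 1) → EuclideanSpace ℂ ι) :
    gramResidual (fun j => U (v j)) = gramResidual v := by
  have : gram ℂ (fun j => U (v j)) = gram ℂ v := by
    ext i j; simp
  rw [gramResidual, gramResidual, this]

theorem continuous_gram {k : ℕ} :
    Continuous fun v : Fin k → EuclideanSpace ℂ ι => gram ℂ v := by
  refine continuous_matrix fun i j => ?_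
  simp only [gram_apply]
  fun_prop

/-- The inverse is written as adjugate over determinant, both continuous in the vectors. -/
theorem measurable_gramResidual :
    Measurable (gramResidual : (Fin (m + 1) → EuclideanSpace ℂ ι) → ℝ) := by
  unfold gramResidual
  simp only [Matrix.inv_def, Ring.inverse_eq_inv', Matrix.smul_apply, smul_eq_mul]
  have h1 : Measurable fun v : Fin (m + 1) → EuclideanSpace ℂ ι => (gram ℂ v).det :=
    continuous_gram.matrix_det.measurable
  have h2 : Measurable fun v : Fin (m + 1) → EuclideanSpace ℂ ι => (gram ℂ v).adjugate 0 0 :=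
    (continuous_gram.matrix_adjugate.matrix_elem 0 0).measurable
  fun_prop

theorem measurableSet_linearIndependent {k : ℕ} :
    MeasurableSet {v : Fin k → EuclideanSpace ℂ ι | LinearIndependent ℂ v} := by
  simp only [← det_gram_ne_zero_iff_linearIndependent]
  exact (isOpen_ne_fun continuous_gram.matrix_det continuous_const).measurableSet

instance sFinite_pi_halfGaussian :
    SFinite (Measure.pi fun _ : Fin m => halfGaussian (EuclideanSpace ℂ ι)) :=
  have : SigmaFinite (Measure.pi fun _ : Fin m => halfGaussian (EuclideanSpace ℂ ι)) :=
    inferInstance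
  inferInstance

theorem ae_linearIndependent_halfGaussian (hm : m ≤ Fintype.card ι) :
    ∀ᵐ Y ∂(Measure.pi fun _ : Fin m => halfGaussian (EuclideanSpace ℂ ι)),
      LinearIndependent ℂ Y := by
  induction m with
  | zero => exact ae_of_all _ fun Y => linearIndependent_empty_type
  | succ m ih =>
    have e := measurePreserving_piFinSuccAbove
      (fun _ : Fin (m + 1) => halfGaussian (EuclideanSpace ℂ ι)) 0
    have hset : MeasurableSet {p : EuclideanSpace ℂ ι × (Fin m → EuclideanSpace ℂ ι) |
        LinearIndependent ℂ (Fin.cons p.1 p.2 : Fin (m + 1) → EuclideanSpace ℂ ι)} := by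
      refine measurableSet_linearIndependent.preimage (f := fun p :
        EuclideanSpace ℂ ι × (Fin m → EuclideanSpace ℂ ι) =>
          (Fin.cons p.1 p.2 : Fin (m + 1) → EuclideanSpace ℂ ι)) ?_
      refine measurable_pi_lambda _ fun i => ?_
      refine Fin.cases ?_ (fun i => ?_) i
      · simpa using measurable_fst
      · simpa using! (measurable_pi_apply i).comp measurable_snd
    have key : ∀ᵐ p ∂((halfGaussian (EuclideanSpace ℂ ι)).prod
        (Measure.pi fun _ : Fin m => halfGaussian (EuclideanSpace ℂ ι))),
        LinearIndependent ℂ (Fin.cons p.1 p.2 : Fin (m + 1) → EuclideanSpace ℂ ι) := by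
      -- The order is swapped so that `Y` is fixed first; the new vector then only has to avoid the
      -- span of `Y`, a proper real subspace and hence a null set.
      rw [Measure.ae_prod_iff_ae_ae hset, Measure.ae_ae_comm hset]
      filter_upwards [ih (by omega)] with Y hY
      set S := (Submodule.span ℂ (Set.range Y)).restrictScalars ℝ with hS
      have hS1 : S ≠ ⊤ := by
        intro h
        have h1 : Submodule.span ℂ (Set.range Y) = ⊤ := by
          rwa [hS, Submodule.restrictScalars_eq_top_iff] at h
        have h2 := finrank_span_eq_card hY
        rw [h1, finrank_top, finrank_euclideanSpace, Fintype.card_fin] at h2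
        omega
      have h0 := halfGaussian_absolutelyContinuous (V := EuclideanSpace ℂ ι)
        (Measure.addHaar_submodule _ S hS1)
      filter_upwards [compl_mem_ae_iff.mpr h0] with x hx
      rw [linearIndependent_finCons]
      exact ⟨hY, hx⟩
    have := e.quasiMeasurePreserving.ae key
    filter_upwards [this] with v hv
    convert hv
    exact (Fin.cons_self_tail v).symm

/-- For `v ≠ 0`, extend `u` and `v / ‖v‖` to orthonormal bases and send one basis to the other. -/
theorem exists_linearIsometryEquiv_smul [Nonempty ι] {u : EuclideanSpace ℂ ι} (hu : ‖u‖ = 1)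
    (v : EuclideanSpace ℂ ι) :
    ∃ U : EuclideanSpace ℂ ι ≃ₗᵢ[ℂ] EuclideanSpace ℂ ι, U ((‖v‖ : ℂ) • u) = v := by
  classical
  obtain ⟨i₀⟩ := ‹Nonempty ι›
  have hb : ∀ w : EuclideanSpace ℂ ι, ‖w‖ = 1 →
      ∃ b : OrthonormalBasis ι ℂ (EuclideanSpace ℂ ι), b i₀ = w := by
    intro w hw
    have ho : Orthonormal ℂ (({i₀} : Set ι).domRestrict fun _ : ι => w) := by
      constructor
      · intro _; exact hw
      · rintro ⟨i, rfl⟩ ⟨j, rfl⟩ h; exact absurd rfl h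
    obtain ⟨b, hb⟩ := ho.exists_orthonormalBasis_extension_of_card_eq (by simp)
    exact ⟨b, hb i₀ rfl⟩
  by_cases hv : v = 0
  · exact ⟨LinearIsometryEquiv.refl ℂ _, by simp [hv]⟩
  · have hv' : (‖v‖ : ℂ) ≠ 0 := by simpa using hv
    obtain ⟨b, hb1⟩ := hb u hu
    obtain ⟨b', hb2⟩ := hb ((‖v‖ : ℂ)⁻¹ • v) (by rw [norm_smul]; simp [hv])
    refine ⟨b.equiv b' (Equiv.refl ι), ?_⟩
    rw [map_smul, ← hb1, OrthonormalBasis.equiv_apply_basis, Equiv.refl_apply, hb2,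
      smul_inv_smul₀ hv']

end ComplexColumns

/-! ### Averaging over the first column and over the remaining columns -/

section Averages

variable {ι : Type*} [Fintype ι] {m : ℕ}

theorem gramResidual_cons {Y : Fin m → EuclideanSpace ℂ ι} (hY : LinearIndependent ℂ Y)
    (x : EuclideanSpace ℂ ι) :
    gramResidual (Fin.cons x Y : Fin (m + 1) → EuclideanSpace ℂ ι) =
      ‖(orthSpan Y).orthogonalProjectionOnto x‖ ^ 2 := by
  have h := gramResidual_eq_sq_norm (v := (Fin.cons x Y : Fin (m + 1) → EuclideanSpace ℂ ι))
    (by simpa using hY)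
  simpa using h

theorem gramResidual_cons_le {Y : Fin m → EuclideanSpace ℂ ι} (hY : LinearIndependent ℂ Y)
    (x : EuclideanSpace ℂ ι) :
    gramResidual (Fin.cons x Y : Fin (m + 1) → EuclideanSpace ℂ ι) ≤ ‖x‖ ^ 2 := by
  rw [gramResidual_cons hY]
  gcongr
  exact Submodule.norm_orthogonalProjectionOnto_apply_le _ x

theorem gramResidual_cons_nonneg {Y : Fin m → EuclideanSpace ℂ ι} (hY : LinearIndependent ℂ Y)
    (x : EuclideanSpace ℂ ι) :
    0 ≤ gramResidual (Fin.cons x Y : Fin (m + 1) → EuclideanSpace ℂ ι) := by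
  rw [gramResidual_cons hY]
  positivity

theorem gramResidual_cons_smul {Y : Fin m → EuclideanSpace ℂ ι} (hY : LinearIndependent ℂ Y)
    (r : ℝ) (x : EuclideanSpace ℂ ι) :
    gramResidual (Fin.cons ((r : ℂ) • x) Y : Fin (m + 1) → EuclideanSpace ℂ ι) =
      r ^ 2 * gramResidual (Fin.cons x Y : Fin (m + 1) → EuclideanSpace ℂ ι) := by
  rw [gramResidual_cons hY, gramResidual_cons hY, Complex.coe_smul, map_smul, norm_smul, mul_pow,
    Real.norm_eq_abs, sq_abs]

theorem measurable_gramResidual_cons :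
    Measurable fun p : EuclideanSpace ℂ ι × (Fin m → EuclideanSpace ℂ ι) =>
      gramResidual (Fin.cons p.1 p.2 : Fin (m + 1) → EuclideanSpace ℂ ι) := by
  refine measurable_gramResidual.comp (measurable_pi_lambda _ fun i => ?_)
  refine Fin.cases ?_ (fun i => ?_) i
  · simpa using measurable_fst
  · simpa using! (measurable_pi_apply i).comp measurable_snd

theorem measurable_gramResidual_cons_right (x : EuclideanSpace ℂ ι) :
    Measurable fun Y : Fin m → EuclideanSpace ℂ ι =>
      gramResidual (Fin.cons x Y : Fin (m + 1) → EuclideanSpace ℂ ι) :=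
  Measurable.of_uncurry_left (f := fun (x : EuclideanSpace ℂ ι) (Y : Fin m → EuclideanSpace ℂ ι) =>
    gramResidual (Fin.cons x Y : Fin (m + 1) → EuclideanSpace ℂ ι)) measurable_gramResidual_cons

theorem measurePreserving_linearIsometryEquiv_halfGaussian
    (U : EuclideanSpace ℂ ι ≃ₗᵢ[ℂ] EuclideanSpace ℂ ι) :
    MeasurePreserving U (halfGaussian (EuclideanSpace ℂ ι))
      (halfGaussian (EuclideanSpace ℂ ι)) := by
  refine ⟨U.continuous.measurable, map_halfGaussian U U.symm U.continuous (fun x t => ?_)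
    fun t => U.symm.norm_map t⟩
  rw [EuclideanSpace.real_inner_eq_re_inner, EuclideanSpace.real_inner_eq_re_inner,
    ← U.symm.inner_map_map, U.symm_apply_apply]

/-- The law of `Y` is unitarily invariant, so `Y` may be rotated together with `x`, which leaves the
Gram matrix unchanged. -/
theorem integral_gramResidual_pow_linearIsometryEquiv
    (U : EuclideanSpace ℂ ι ≃ₗᵢ[ℂ] EuclideanSpace ℂ ι) (x : EuclideanSpace ℂ ι) (n : ℕ) :
    ∫ Y, gramResidual (Fin.cons (U x) Y : Fin (m + 1) → EuclideanSpace ℂ ι) ^ n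
        ∂(Measure.pi fun _ : Fin m => halfGaussian (EuclideanSpace ℂ ι)) =
      ∫ Y, gramResidual (Fin.cons x Y : Fin (m + 1) → EuclideanSpace ℂ ι) ^ n
        ∂(Measure.pi fun _ : Fin m => halfGaussian (EuclideanSpace ℂ ι)) := by
  have hmp := measurePreserving_pi
    (fun _ : Fin m => halfGaussian (EuclideanSpace ℂ ι))
    (fun _ : Fin m => halfGaussian (EuclideanSpace ℂ ι))
    (fun _ => measurePreserving_linearIsometryEquiv_halfGaussian U)
  have hmeas : Measurable fun Y : Fin m → EuclideanSpace ℂ ι =>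
      gramResidual (Fin.cons (U x) Y : Fin (m + 1) → EuclideanSpace ℂ ι) ^ n :=
    (measurable_gramResidual_cons_right _).pow_const n
  rw [← hmp.map_eq, integral_map hmp.measurable.aemeasurable hmeas.aestronglyMeasurable]
  rw [hmp.map_eq]
  refine integral_congr_ae (ae_of_all _ fun Y => ?_)
  simp only
  rw [← gramResidual_linearIsometryEquiv U (Fin.cons x Y)]
  congr 2
  funext j
  refine Fin.cases ?_ (fun i => ?_) j <;> simp

theorem integrable_gramResidual_pow_prod (hm : m ≤ Fintype.card ι) (n : ℕ) :
    Integrable (fun p : EuclideanSpace ℂ ι × (Fin m → EuclideanSpace ℂ ι) =>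
      gramResidual (Fin.cons p.1 p.2 : Fin (m + 1) → EuclideanSpace ℂ ι) ^ n)
      ((halfGaussian (EuclideanSpace ℂ ι)).prod
        (Measure.pi fun _ : Fin m => halfGaussian (EuclideanSpace ℂ ι))) := by
  have h := (integrable_sq_norm_pow_halfGaussian (V := EuclideanSpace ℂ ι) n).comp_fst
    (Measure.pi fun _ : Fin m => halfGaussian (EuclideanSpace ℂ ι))
  refine h.mono' (measurable_gramResidual_cons.pow_const n).aestronglyMeasurable ?_
  have hli := Measure.quasiMeasurePreserving_snd (μ := halfGaussian (EuclideanSpace ℂ ι)) |>.ae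
    (ae_linearIndependent_halfGaussian hm)
  filter_upwards [hli] with p hp
  rw [norm_pow, Real.norm_of_nonneg (gramResidual_cons_nonneg hp _)]
  exact pow_le_pow_left₀ (gramResidual_cons_nonneg hp _) (gramResidual_cons_le hp _) n

/-- The moments of the squared length of the projection of a fixed vector onto the orthogonal
complement of a random subspace. -/
theorem integral_gramResidual_pow (hm : m < Fintype.card ι) (x : EuclideanSpace ℂ ι) (n : ℕ) :
    ∫ Y, gramResidual (Fin.cons x Y : Fin (m + 1) → EuclideanSpace ℂ ι) ^ n
        ∂(Measure.pi fun _ : Fin m => halfGaussian (EuclideanSpace ℂ ι)) =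
      ((Fintype.card ι - m).ascFactorial n : ℝ) / ((Fintype.card ι).ascFactorial n : ℝ) *
        (‖x‖ ^ 2) ^ n := by
  classical
  have : Nonempty ι := Fintype.card_pos_iff.mp (by omega)
  set ν := Measure.pi fun _ : Fin m => halfGaussian (EuclideanSpace ℂ ι) with hν
  obtain ⟨i₀⟩ := ‹Nonempty ι›
  set u : EuclideanSpace ℂ ι := EuclideanSpace.single i₀ 1 with hu
  have hu1 : ‖u‖ = 1 := by simp [hu]
  set c := ∫ Y, gramResidual (Fin.cons u Y : Fin (m + 1) → EuclideanSpace ℂ ι) ^ n ∂ν with hc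
  -- Every `x` is a rotated multiple of the unit vector `u`, so a single constant `c` is unknown.
  have hx : ∀ x, ∫ Y, gramResidual (Fin.cons x Y : Fin (m + 1) → EuclideanSpace ℂ ι) ^ n ∂ν =
      c * (‖x‖ ^ 2) ^ n := by
    intro x
    have : Nonempty ι := ⟨i₀⟩
    obtain ⟨U, hU⟩ := exists_linearIsometryEquiv_smul hu1 x
    conv_lhs => rw [← hU]
    rw [integral_gramResidual_pow_linearIsometryEquiv, hc, ← integral_mul_const]
    refine integral_congr_ae ?_
    filter_upwards [ae_linearIndependent_halfGaussian hm.le] with Y hY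
    rw [gramResidual_cons_smul hY, mul_pow, mul_comm]
  -- To find `c`, let `x` be Gaussian and integrate in both orders; each order yields known Gaussian
  -- moments.
  have h1 : ∫ x, ∫ Y, gramResidual (Fin.cons x Y : Fin (m + 1) → EuclideanSpace ℂ ι) ^ n ∂ν
      ∂(halfGaussian (EuclideanSpace ℂ ι)) = c * (Fintype.card ι).ascFactorial n := by
    simp only [hx]
    rw [integral_const_mul, integral_sq_norm_pow_halfGaussian (p := Fintype.card ι)]
    rw [finrank_real_of_complex, finrank_euclideanSpace]
  rw [integral_integral_swap (integrable_gramResidual_pow_prod hm.le n)] at h1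
  have h2 : ∫ Y, ∫ x, gramResidual (Fin.cons x Y : Fin (m + 1) → EuclideanSpace ℂ ι) ^ n
      ∂(halfGaussian (EuclideanSpace ℂ ι)) ∂ν = (Fintype.card ι - m).ascFactorial n := by
    have : ∀ᵐ Y ∂ν, ∫ x, gramResidual (Fin.cons x Y : Fin (m + 1) → EuclideanSpace ℂ ι) ^ n
        ∂(halfGaussian (EuclideanSpace ℂ ι)) = (Fintype.card ι - m).ascFactorial n := by
      filter_upwards [ae_linearIndependent_halfGaussian hm.le] with Y hY
      simp only [gramResidual_cons hY]
      exact integral_sq_norm_orthogonalProjection_pow _ (finrank_orthSpan hY) n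
    refine (integral_congr_ae this).trans ?_
    rw [integral_const, probReal_univ, one_smul]
  have hpos : ((Fintype.card ι).ascFactorial n : ℝ) ≠ 0 := by
    exact_mod_cast (Nat.ascFactorial_pos_of_pos (by omega) n).ne'
  rw [hx]
  congr 1
  rw [eq_div_iff hpos, ← h1, h2]

theorem integral_exp_gramResidual (hm : m < Fintype.card ι) (x : EuclideanSpace ℂ ι) (t : ℝ) :
    ∫ Y, Real.exp (t * gramResidual (Fin.cons x Y : Fin (m + 1) → EuclideanSpace ℂ ι))
        ∂(Measure.pi fun _ : Fin m => halfGaussian (EuclideanSpace ℂ ι)) =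
      kummer1F1 ((Fintype.card ι - m : ℕ) : ℝ) (Fintype.card ι : ℝ) (t * ‖x‖ ^ 2) := by
  set ν := Measure.pi fun _ : Fin m => halfGaussian (EuclideanSpace ℂ ι) with hν
  have hmeas := measurable_gramResidual_cons_right (m := m) x
  have key : HasSum (fun n : ℕ => ∫ Y,
      (t * gramResidual (Fin.cons x Y : Fin (m + 1) → EuclideanSpace ℂ ι)) ^ n / (n ! : ℝ) ∂ν)
      (∫ Y, Real.exp (t * gramResidual (Fin.cons x Y : Fin (m + 1) → EuclideanSpace ℂ ι)) ∂ν) := by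
    refine hasSum_integral_of_dominated_convergence
      (fun n _ => (|t| * ‖x‖ ^ 2) ^ n / (n ! : ℝ)) (fun n => ?_) (fun n => ?_) ?_ ?_ ?_
    · exact (((hmeas.const_mul t).pow_const n).div_const _).aestronglyMeasurable
    · filter_upwards [ae_linearIndependent_halfGaussian hm.le] with Y hY
      rw [norm_div, norm_pow, norm_mul, Real.norm_of_nonneg (gramResidual_cons_nonneg hY x),
        Real.norm_natCast, Real.norm_eq_abs]
      have := gramResidual_cons_le hY x
      have := gramResidual_cons_nonneg hY x
      gcongr
    · exact ae_of_all _ fun Y => Real.summable_pow_div_factorial _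
    · exact integrable_const _
    · refine ae_of_all _ fun Y => ?_
      have := NormedSpace.expSeries_div_hasSum_exp
        (t * gramResidual (Fin.cons x Y : Fin (m + 1) → EuclideanSpace ℂ ι))
      rwa [← Real.exp_eq_exp_ℝ] at this
  rw [← key.tsum_eq, kummer1F1]
  congr 1
  funext n
  simp only [mul_pow t, mul_div_right_comm]
  rw [integral_const_mul, integral_gramResidual_pow hm, kummerTerm_natCast]
  ring

variable {τ : ℝ}

theorem measurable_exp_gramResidual_cons_add (h : EuclideanSpace ℂ ι) :
    Measurable fun p : EuclideanSpace ℂ ι × (Fin m → EuclideanSpace ℂ ι) =>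
      Real.exp (τ * gramResidual (Fin.cons (p.1 + h) p.2 : Fin (m + 1) → EuclideanSpace ℂ ι)) :=
  ((measurable_gramResidual_cons.comp
    ((measurable_fst.add_const h).prodMk measurable_snd)).const_mul τ).exp

theorem integrable_exp_gramResidual_cons_add {Y : Fin m → EuclideanSpace ℂ ι}
    (hY : LinearIndependent ℂ Y) (hτ : τ < 1) (h : EuclideanSpace ℂ ι) :
    Integrable (fun x =>
      Real.exp (τ * gramResidual (Fin.cons (x + h) Y : Fin (m + 1) → EuclideanSpace ℂ ι)))
      (halfGaussian (EuclideanSpace ℂ ι)) := by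
  simp only [gramResidual_cons hY]
  exact integrable_exp_sq_norm_orthogonalProjection_add _ hτ h

theorem integral_exp_gramResidual_cons_add {Y : Fin m → EuclideanSpace ℂ ι}
    (hY : LinearIndependent ℂ Y) (hτ : τ < 1) (h : EuclideanSpace ℂ ι) :
    ∫ x, Real.exp (τ * gramResidual (Fin.cons (x + h) Y : Fin (m + 1) → EuclideanSpace ℂ ι))
        ∂(halfGaussian (EuclideanSpace ℂ ι)) =
      1 / (1 - τ) ^ (Fintype.card ι - m) * Real.exp (τ / (1 - τ) *
        gramResidual (Fin.cons h Y : Fin (m + 1) → EuclideanSpace ℂ ι)) := by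
  simp only [gramResidual_cons hY]
  rw [integral_exp_sq_norm_orthogonalProjection_add _ hτ h (finrank_orthSpan hY)]
  ring_nf

/-- For almost every `Y` the inner integral over the first column is explicit, and it is bounded
because the residual of `h` is at most `‖h‖²`. -/
theorem integrable_exp_gramResidual_prod (hm : m < Fintype.card ι) (hτ : τ < 1)
    (h : EuclideanSpace ℂ ι) :
    Integrable (fun p : EuclideanSpace ℂ ι × (Fin m → EuclideanSpace ℂ ι) =>
      Real.exp (τ * gramResidual (Fin.cons (p.1 + h) p.2 : Fin (m + 1) → EuclideanSpace ℂ ι)))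
      ((halfGaussian (EuclideanSpace ℂ ι)).prod
        (Measure.pi fun _ : Fin m => halfGaussian (EuclideanSpace ℂ ι))) := by
  rw [integrable_prod_iff' (measurable_exp_gramResidual_cons_add h).aestronglyMeasurable]
  constructor
  · filter_upwards [ae_linearIndependent_halfGaussian hm.le] with Y hY
    exact integrable_exp_gramResidual_cons_add hY hτ h
  · have hmeas : Measurable fun Y : Fin m → EuclideanSpace ℂ ι =>
        1 / (1 - τ) ^ (Fintype.card ι - m) * Real.exp (τ / (1 - τ) *
          gramResidual (Fin.cons h Y : Fin (m + 1) → EuclideanSpace ℂ ι)) :=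
      ((measurable_gramResidual_cons_right h).const_mul _).exp.const_mul _
    have hi : Integrable (fun Y : Fin m → EuclideanSpace ℂ ι =>
        1 / (1 - τ) ^ (Fintype.card ι - m) * Real.exp (τ / (1 - τ) *
          gramResidual (Fin.cons h Y : Fin (m + 1) → EuclideanSpace ℂ ι)))
        (Measure.pi fun _ : Fin m => halfGaussian (EuclideanSpace ℂ ι)) := by
      refine (integrable_const (1 / (1 - τ) ^ (Fintype.card ι - m) *
        Real.exp (|τ / (1 - τ)| * ‖h‖ ^ 2))).mono' hmeas.aestronglyMeasurable ?_
      filter_upwards [ae_linearIndependent_halfGaussian hm.le] with Y hY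
      have h1 : 0 < 1 - τ := by linarith
      rw [Real.norm_of_nonneg (by positivity)]
      have h0 := gramResidual_cons_nonneg hY h
      refine mul_le_mul_of_nonneg_left (Real.exp_le_exp.mpr ?_) (by positivity)
      exact (mul_le_mul_of_nonneg_right (le_abs_self _) h0).trans
        (mul_le_mul_of_nonneg_left (gramResidual_cons_le hY h) (abs_nonneg _))
    refine hi.congr ?_
    filter_upwards [ae_linearIndependent_halfGaussian hm.le] with Y hY
    simp only [Real.norm_of_nonneg (Real.exp_nonneg _)]
    exact (integral_exp_gramResidual_cons_add hY hτ h).symm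

theorem integral_exp_gramResidual_prod (hm : m < Fintype.card ι) (hτ : τ < 1)
    (h : EuclideanSpace ℂ ι) :
    ∫ p : EuclideanSpace ℂ ι × (Fin m → EuclideanSpace ℂ ι),
      Real.exp (τ * gramResidual (Fin.cons (p.1 + h) p.2 : Fin (m + 1) → EuclideanSpace ℂ ι))
      ∂((halfGaussian (EuclideanSpace ℂ ι)).prod
        (Measure.pi fun _ : Fin m => halfGaussian (EuclideanSpace ℂ ι))) =
    1 / (1 - τ) ^ (Fintype.card ι - m) *
      kummer1F1 ((Fintype.card ι - m : ℕ) : ℝ) (Fintype.card ι : ℝ) (τ / (1 - τ) * ‖h‖ ^ 2) := by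
  rw [integral_prod_symm _ (integrable_exp_gramResidual_prod hm hτ h),
    ← integral_exp_gramResidual hm, ← integral_const_mul]
  refine integral_congr_ae ?_
  filter_upwards [ae_linearIndependent_halfGaussian hm.le] with Y hY
  exact integral_exp_gramResidual_cons_add hY hτ h

/-- The moment generating function of the Gram residual of a standard Gaussian matrix whose first column is shifted. -/
theorem integrable_and_integral_exp_gramResidual (hm : m < Fintype.card ι) (hτ : τ < 1)
    (h : EuclideanSpace ℂ ι) :
    Integrable (fun v : Fin (m + 1) → EuclideanSpace ℂ ι =>
      Real.exp (τ * gramResidual (v + Pi.single 0 h)))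
      (Measure.pi fun _ : Fin (m + 1) => halfGaussian (EuclideanSpace ℂ ι)) ∧
    ∫ v : Fin (m + 1) → EuclideanSpace ℂ ι, Real.exp (τ * gramResidual (v + Pi.single 0 h))
      ∂(Measure.pi fun _ : Fin (m + 1) => halfGaussian (EuclideanSpace ℂ ι)) =
    1 / (1 - τ) ^ (Fintype.card ι - m) *
      kummer1F1 ((Fintype.card ι - m : ℕ) : ℝ) (Fintype.card ι : ℝ) (τ / (1 - τ) * ‖h‖ ^ 2) := by
  have e := measurePreserving_piFinSuccAbove
    (fun _ : Fin (m + 1) => halfGaussian (EuclideanSpace ℂ ι)) 0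
  have hF : (fun v : Fin (m + 1) → EuclideanSpace ℂ ι =>
      Real.exp (τ * gramResidual (v + Pi.single 0 h))) =
      (fun p : EuclideanSpace ℂ ι × (Fin m → EuclideanSpace ℂ ι) =>
        Real.exp (τ * gramResidual (Fin.cons (p.1 + h) p.2 : Fin (m + 1) → EuclideanSpace ℂ ι))) ∘
      (MeasurableEquiv.piFinSuccAbove (fun _ : Fin (m + 1) => EuclideanSpace ℂ ι) 0) := by
    funext v
    have : v + Pi.single 0 h = Fin.cons (v 0 + h) (Fin.tail v) := by
      funext j
      refine Fin.cases ?_ (fun i => ?_) j <;> simp [Fin.tail]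
    rw [this]
    rfl
  rw [hF]
  refine ⟨(e.integrable_comp_emb (MeasurableEquiv.measurableEmbedding _)).mpr
    (integrable_exp_gramResidual_prod hm hτ h), ?_⟩
  rw [← integral_exp_gramResidual_prod hm hτ h]
  exact e.integral_comp (MeasurableEquiv.measurableEmbedding _)
    fun p : EuclideanSpace ℂ ι × (Fin m → EuclideanSpace ℂ ι) =>
      Real.exp (τ * gramResidual (Fin.cons (p.1 + h) p.2 : Fin (m + 1) → EuclideanSpace ℂ ι))

end Averages

/-! ### A factorization adapted to one row -/

section Factorization

open scoped MatrixOrder in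
theorem Matrix.PosSemidef.exists_eq_mul_conjTranspose {n : Type*} [Fintype n]
    {Z : Matrix n n ℂ} (hZ : Z.PosSemidef) : ∃ A : Matrix n n ℂ, Z = A * Aᴴ := by
  classical
  obtain ⟨B, hB⟩ := CStarAlgebra.nonneg_iff_eq_star_mul_self.mp hZ.nonneg
  exact ⟨Bᴴ, by simpa [star_eq_conjTranspose] using hB⟩

/-- A positive definite matrix factors as `L Lᴴ` where the row of `L` with a given index is a
positive multiple of a unit vector. -/
theorem Matrix.PosDef.exists_eq_mul_conjTranspose_row {n : Type*} [Fintype n] [DecidableEq n]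
    {Z : Matrix n n ℂ} (hZ : Z.PosDef) (i₀ : n) :
    ∃ (L : Matrix n n ℂ) (ρ : ℝ), 0 < ρ ∧ L * Lᴴ = Z ∧ L i₀ = Pi.single i₀ (ρ : ℂ) := by
  obtain ⟨A, hA⟩ := hZ.posSemidef.exists_eq_mul_conjTranspose
  -- Any factor `A` may be multiplied on the right by a unitary `U`. Entry `j` of row `i₀` of `A U`
  -- is the inner product of `w` with column `j` of `U`, so column `i₀` is taken along `w`.
  set w : EuclideanSpace ℂ n := WithLp.toLp 2 (star (A i₀)) with hw
  have hw0 : w ≠ 0 := by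
    intro h0
    have h1 : A i₀ = 0 := by
      have : star (A i₀) = 0 := congrArg WithLp.ofLp h0
      simpa using this
    have h2 : 0 < Z i₀ i₀ := hZ.diag_pos
    rw [hA, Matrix.mul_apply] at h2
    simp [h1] at h2
  have hρ : 0 < ‖w‖ := norm_pos_iff.mpr hw0
  have ho : Orthonormal ℂ (({i₀} : Set n).domRestrict fun _ : n => (‖w‖ : ℂ)⁻¹ • w) := by
    constructor
    · intro _
      simp [Set.domRestrict, norm_smul, hw0]
    · rintro ⟨i, rfl⟩ ⟨j, rfl⟩ h; exact absurd rfl h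
  obtain ⟨b, hb⟩ := ho.exists_orthonormalBasis_extension_of_card_eq (by simp)
  have hb0 : w = (‖w‖ : ℂ) • b i₀ := by
    rw [hb i₀ rfl, smul_inv_smul₀]; simpa using hw0
  set U : Matrix n n ℂ := Matrix.of fun k j => b j k with hU
  have hUU : U * Uᴴ = 1 := by
    rw [mul_eq_one_comm]
    ext i j
    have := orthonormal_iff_ite.mp b.orthonormal i j
    rw [PiLp.inner_apply] at this
    simpa [Matrix.mul_apply, hU, Matrix.one_apply, mul_comm] using this
  refine ⟨A * U, ‖w‖, hρ, ?_, ?_⟩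
  · rw [conjTranspose_mul, Matrix.mul_assoc, ← Matrix.mul_assoc U, hUU, Matrix.one_mul, hA]
  · funext j
    have h1 : (A * U) i₀ j = inner ℂ w (b j) := by
      rw [PiLp.inner_apply, Matrix.mul_apply]
      simp [hU, hw, mul_comm]
    have h2 : inner ℂ w (b j) = inner ℂ ((‖w‖ : ℂ) • b i₀) (b j) :=
      congrArg (fun z => inner ℂ z (b j)) hb0
    rw [h1, h2, inner_smul_left, orthonormal_iff_ite.mp b.orthonormal i₀ j, Pi.single_apply]
    simp [eq_comm]

end Factorization

/-! ### The law of the whitened channel -/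

section Law

variable {Ω : Type*} [MeasurableSpace Ω] {NR k : ℕ}

/-- The columns of a complex matrix, as vectors of a Euclidean space. -/
def euclideanCols (M : Matrix (Fin NR) (Fin k) ℂ) : Fin k → EuclideanSpace ℂ (Fin NR) :=
  fun j => WithLp.toLp 2 fun i => M i j

theorem gram_euclideanCols (M : Matrix (Fin NR) (Fin k) ℂ) :
    gram ℂ (euclideanCols M) = Mᴴ * M := by
  ext i j
  simp [euclideanCols, PiLp.inner_apply, Matrix.mul_apply, mul_comm]

theorem aemeasurable_euclideanCols_mul {P : Measure Ω} {X : Ω → Matrix (Fin NR) (Fin k) ℂ}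
    (hX : ∀ i, AEMeasurable (fun ω j => star (X ω i j)) P) (C : Matrix (Fin k) (Fin k) ℂ) :
    AEMeasurable (fun ω => euclideanCols (X ω * C)) P := by
  refine aemeasurable_pi_lambda _ fun j => ?_
  refine (PiLp.continuous_toLp 2 _).measurable.comp_aemeasurable
    (aemeasurable_pi_lambda _ fun i => ?_)
  simp only [Matrix.mul_apply]
  refine Finset.aemeasurable_fun_sum _ fun l _ => AEMeasurable.mul_const ?_ _
  have := (Complex.continuous_conj.measurable.comp_aemeasurable
    ((measurable_pi_apply l).comp_aemeasurable (hX i)))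
  simpa [Function.comp_def] using this

/-- A matrix with independent complex Gaussian rows, whitened on the right, has independent
standard complex Gaussian columns. -/
theorem map_euclideanCols_mul_eq_pi {P : Measure Ω} [IsProbabilityMeasure P]
    {X : Ω → Matrix (Fin NR) (Fin k) ℂ} {R C : Matrix (Fin k) (Fin k) ℂ}
    (hind : iIndepFun (fun (i : Fin NR) (ω : Ω) (j : Fin k) => star (X ω i j)) P)
    (hlaw : ∀ i, IsComplexGaussian P (fun ω j => star (X ω i j)) 0 R)
    (hC : Cᴴ * R * C = 1) :
    P.map (fun ω => euclideanCols (X ω * C)) =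
      Measure.pi fun _ : Fin k => halfGaussian (EuclideanSpace ℂ (Fin NR)) := by
  have hm : AEMeasurable (fun ω => euclideanCols (X ω * C)) P :=
    aemeasurable_euclideanCols_mul (fun i => (hlaw i).1) C
  have : IsProbabilityMeasure (P.map fun ω => euclideanCols (X ω * C)) :=
    Measure.isProbabilityMeasure_map hm
  rw [← charFun_eq_pi_iff]
  intro t
  -- The test vectors `t` are indexed by columns, whereas independence is by rows. Regrouping by
  -- rows gives test vectors `C s_i`, and whitening reduces their quadratic forms to `∑ j, ‖t j
  -- i‖²`, so the exponent also splits over columns.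
  set s : Fin NR → Fin k → ℂ := fun i j => star (t j i) with hs
  have hinner : ∀ ω, inner ℝ (WithLp.toLp 2 (euclideanCols (X ω * C))) t =
      ∑ i, (star (C *ᵥ s i) ⬝ᵥ fun j => star (X ω i j)).re := by
    intro ω
    have h1 : ∀ i, (star (C *ᵥ s i) ⬝ᵥ fun j => star (X ω i j)) =
        ∑ j, t j i * star ((X ω * C) i j) := by
      intro i
      simp only [dotProduct, Pi.star_apply, mulVec, hs, Matrix.mul_apply, star_sum, star_mul,
        star_star, Finset.sum_mul, Finset.mul_sum]
      rw [Finset.sum_comm]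
      refine Finset.sum_congr rfl fun j _ => Finset.sum_congr rfl fun l _ => ?_
      ring
    simp only [h1]
    rw [PiLp.inner_apply]
    simp only [PiLp.inner_apply, Complex.re_sum]
    rw [Finset.sum_comm]
    rfl
  have hrow : ∀ i, ∫ ω, Complex.exp (Complex.I *
      ((star (C *ᵥ s i) ⬝ᵥ fun j => star (X ω i j)).re : ℂ)) ∂P =
      Complex.exp (-(∑ j, (‖t j i‖ : ℂ) ^ 2) / 4) := by
    intro i
    rw [(hlaw i).2 (C *ᵥ s i)]
    have : star (C *ᵥ s i) ⬝ᵥ (R *ᵥ (C *ᵥ s i)) = ∑ j, (‖t j i‖ : ℂ) ^ 2 := by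
      rw [star_mulVec, ← dotProduct_mulVec, mulVec_mulVec, mulVec_mulVec, hC,
        one_mulVec]
      simp only [dotProduct, Pi.star_apply, hs, star_star]
      refine Finset.sum_congr rfl fun j _ => ?_
      exact Complex.mul_conj' (t j i)
    rw [this]
    simp [neg_div]
  rw [charFun_apply, integral_map (PiLp.continuous_toLp 2 _).measurable.aemeasurable
    (Continuous.aestronglyMeasurable (by fun_prop)), integral_map hm
    (Continuous.aestronglyMeasurable (by fun_prop))]
  simp only [hinner]
  have hprod := hind.integral_fun_prod_comp (fun i => (hlaw i).1) (f := fun i x =>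
    Complex.exp (Complex.I * ((star (C *ᵥ s i) ⬝ᵥ x).re : ℂ)))
    (fun i => Continuous.aestronglyMeasurable (by
      simp only [dotProduct]; fun_prop))
  simp only [hrow] at hprod
  simp only [charFun_halfGaussian]
  have h1 : ∀ ω, Complex.exp (((∑ i, (star (C *ᵥ s i) ⬝ᵥ fun j => star (X ω i j)).re : ℝ) : ℂ) *
      Complex.I) = ∏ i, Complex.exp (Complex.I *
        ((star (C *ᵥ s i) ⬝ᵥ fun j => star (X ω i j)).re : ℂ)) := by
    intro ω
    rw [← Complex.exp_sum, ← Finset.mul_sum, mul_comm]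
    push_cast
    rfl
  simp only [h1]
  rw [hprod, ← Complex.exp_sum, ← Complex.exp_sum]
  congr 1
  rw [← Finset.sum_div, ← Finset.sum_div, Finset.sum_neg_distrib, Finset.sum_neg_distrib,
    Finset.sum_comm]
  congr 2
  refine Finset.sum_congr rfl fun j _ => ?_
  rw [← Complex.ofReal_pow, EuclideanSpace.norm_sq_eq]
  push_cast
  rfl

end Law

/-! ### The zero-forcing SNR and its generating function -/

section ZeroForcing

variable {NR m : ℕ}

/-- The zero-forcing SNR in terms of the Gram residual of a transformed channel matrix. -/
theorem zfSNR_eq_gramResidual (Γs : ℝ) (H : Matrix (Fin NR) (Fin (m + 1)) ℂ)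
    {L : Matrix (Fin (m + 1)) (Fin (m + 1)) ℂ} (hL : IsUnit L.det) {ρ : ℝ}
    (hrow : L 0 = Pi.single 0 (ρ : ℂ)) :
    zfSNR Γs H = Γs / ρ ^ 2 * gramResidual (euclideanCols (H * L)) := by
  have hLs : IsUnit Lᴴ.det := by rw [det_conjTranspose]; exact hL.star
  -- No rank condition on `H` is needed: reversing a product under `Matrix.inv` holds for singular
  -- factors too, and only `L` has to cancel.
  have h1 : (Hᴴ * H)⁻¹ = L * (gram ℂ (euclideanCols (H * L)))⁻¹ * Lᴴ := by
    have h0 : (H * L)ᴴ * (H * L) = Lᴴ * (Hᴴ * H * L) := by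
      rw [conjTranspose_mul]; simp only [Matrix.mul_assoc]
    rw [gram_euclideanCols, h0, Matrix.mul_inv_rev, Matrix.mul_inv_rev, ← Matrix.mul_assoc,
      ← Matrix.mul_assoc, Matrix.mul_nonsing_inv _ hL, Matrix.one_mul, Matrix.mul_assoc,
      Matrix.nonsing_inv_mul _ hLs, Matrix.mul_one]
  have h2 : (Hᴴ * H)⁻¹ 0 0 = ((ρ ^ 2 : ℝ) : ℂ) * (gram ℂ (euclideanCols (H * L)))⁻¹ 0 0 := by
    rw [h1, Matrix.mul_apply, Finset.sum_eq_single 0 (fun l _ hl => by simp [hrow, hl]) (by simp)]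
    simp [hrow, Matrix.mul_apply, Pi.single_apply]
    ring
  rw [zfSNR, h2, Complex.re_ofReal_mul, gramResidual, div_mul_div_comm, mul_one]

/-- The whitened channel matrix is a random matrix plus a deterministic first column. -/
theorem euclideanCols_channelMatrix_mul (K : ℝ) {Hdn : Matrix (Fin NR) (Fin (m + 1)) ℂ}
    (hdn : ∀ i j, j ≠ 0 → Hdn i j = 0) (X : Matrix (Fin NR) (Fin (m + 1)) ℂ)
    {L : Matrix (Fin (m + 1)) (Fin (m + 1)) ℂ} {ρ : ℝ} (hrow : L 0 = Pi.single 0 (ρ : ℂ)) :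
    euclideanCols (channelMatrix K Hdn X * L) =
      euclideanCols (X * (((Real.sqrt (1 / (K + 1)) : ℝ) : ℂ) • L)) +
        (Pi.single 0 (WithLp.toLp 2 fun i =>
          (ρ : ℂ) * (((Real.sqrt (K / (K + 1)) : ℝ) : ℂ) * Hdn i 0)) :
            Fin (m + 1) → EuclideanSpace ℂ (Fin NR)) := by
  have h1 : ∀ i j, (Hdn * L) i j = Hdn i 0 * (Pi.single 0 (ρ : ℂ) : Fin (m + 1) → ℂ) j := by
    intro i j
    rw [Matrix.mul_apply, Finset.sum_eq_single 0 (fun l _ hl => by rw [hdn i l hl, zero_mul])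
      (by simp), hrow]
  funext j
  ext i
  simp only [euclideanCols, channelMatrix, Matrix.add_mul, Matrix.smul_mul, Matrix.mul_smul,
    Matrix.add_apply, Matrix.smul_apply, h1, Pi.add_apply, PiLp.add_apply, smul_eq_mul]
  by_cases hj : j = 0
  · subst hj
    simp
    ring
  · simp [hj]

theorem integrable_and_mgf_zfSNR (hle : m + 1 ≤ NR) {Ω : Type*} [MeasurableSpace Ω]
    (P : Measure Ω) [IsProbabilityMeasure P] {Γs K : ℝ} {Hdn : Matrix (Fin NR) (Fin (m + 1)) ℂ}
    {RT : Matrix (Fin (m + 1)) (Fin (m + 1)) ℂ} {Hrn : Ω → Matrix (Fin NR) (Fin (m + 1)) ℂ}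
    (hΓ : 0 < Γs) (hH : IsRicianRayleigh P K Hdn RT Hrn) :
    0 < snrScale Γs K RT ∧ 0 < ricianParam K Hdn RT ∧ ∀ s : ℝ, snrScale Γs K RT * s < 1 →
      Integrable (fun ω => Real.exp (s * zfSNR Γs (channelMatrix K Hdn (Hrn ω)))) P ∧
      ∫ ω, Real.exp (s * zfSNR Γs (channelMatrix K Hdn (Hrn ω))) ∂P =
        1 / (1 - snrScale Γs K RT * s) ^ (NR - m) *
          kummer1F1 ((NR - m : ℕ) : ℝ) (NR : ℝ)
            (ricianParam K Hdn RT * (snrScale Γs K RT * s / (1 - snrScale Γs K RT * s))) := by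
  have hK := hH.K_pos
  have hK1 : 0 < 1 / (K + 1) := by positivity
  set S : Matrix (Fin (m + 1)) (Fin (m + 1)) ℂ := ((1 / (K + 1) : ℝ) : ℂ) • RT with hS
  have hSpos : S.PosDef := hH.corr_posDef.smul (by exact_mod_cast hK1)
  -- Factoring the inverse covariance makes `L` a whitening matrix and gives `ρ² = invCov11 K RT`.
  -- The special row keeps the deterministic part in column `0`.
  obtain ⟨L, ρ, hρ, hLL, hrow⟩ := hSpos.inv.exists_eq_mul_conjTranspose_row 0
  have hLdet : IsUnit L.det := by
    have h1 : IsUnit (S⁻¹).det := (isUnit_iff_isUnit_det _).mp hSpos.inv.isUnit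
    rw [← hLL, det_mul] at h1
    exact isUnit_of_mul_isUnit_left h1
  have hLsdet : IsUnit Lᴴ.det := by rw [det_conjTranspose]; exact hLdet.star
  have hSdet : IsUnit S.det := (isUnit_iff_isUnit_det _).mp hSpos.isUnit
  have hinv : invCov11 K RT = ρ ^ 2 := by
    have h1 : S⁻¹ 0 0 = ((ρ ^ 2 : ℝ) : ℂ) := by
      rw [← hLL, Matrix.mul_apply]
      simp only [conjTranspose_apply, hrow, Pi.single_apply]
      simp
      ring
    rw [invCov11, ← hS, h1, Complex.ofReal_re]
  have hwhite : Lᴴ * S * L = 1 := by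
    have h1 : S = Lᴴ⁻¹ * L⁻¹ := by
      rw [← Matrix.mul_inv_rev, hLL, Matrix.nonsing_inv_nonsing_inv _ hSdet]
    rw [h1, ← Matrix.mul_assoc, Matrix.mul_nonsing_inv _ hLsdet, Matrix.one_mul,
      Matrix.nonsing_inv_mul _ hLdet]
  -- `C` absorbs the scaling of the random part, so it whitens `RT` itself.
  set C : Matrix (Fin (m + 1)) (Fin (m + 1)) ℂ := ((Real.sqrt (1 / (K + 1)) : ℝ) : ℂ) • L with hC
  have hCRC : Cᴴ * RT * C = 1 := by
    rw [← hwhite, hC, hS, conjTranspose_smul]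
    simp only [Matrix.smul_mul, Matrix.mul_smul, smul_smul]
    congr 1
    rw [Complex.star_def, Complex.conj_ofReal, ← Complex.ofReal_mul, Real.mul_self_sqrt hK1.le]
  set h : EuclideanSpace ℂ (Fin NR) := WithLp.toLp 2 fun i =>
    (ρ : ℂ) * (((Real.sqrt (K / (K + 1)) : ℝ) : ℂ) * Hdn i 0) with hh
  have hnorm : ricianParam K Hdn RT = ‖h‖ ^ 2 := by
    rw [ricianParam, hinv, EuclideanSpace.norm_sq_eq, Finset.mul_sum]
    refine Finset.sum_congr rfl fun i _ => ?_
    rw [hh]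
    simp only
    rw [norm_mul (ρ : ℂ), mul_pow, Complex.norm_real, Real.norm_eq_abs, sq_abs]
  have hΓ1 : snrScale Γs K RT = Γs / ρ ^ 2 := by rw [snrScale, hinv]
  have hsnr : ∀ ω, zfSNR Γs (channelMatrix K Hdn (Hrn ω)) =
      snrScale Γs K RT * gramResidual (euclideanCols (Hrn ω * C) + Pi.single 0 h) := by
    intro ω
    rw [zfSNR_eq_gramResidual Γs _ hLdet hrow,
      euclideanCols_channelMatrix_mul K hH.rayleigh _ hrow, hΓ1]
  have hlaw := map_euclideanCols_mul_eq_pi hH.rows_indep hH.rows_law hCRC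
  have hmeas := aemeasurable_euclideanCols_mul (fun i => (hH.rows_law i).1) C
  refine ⟨by rw [hΓ1]; positivity, ?_, fun s hs => ?_⟩
  · rw [hnorm]
    have hne : h ≠ 0 := by
      obtain ⟨i, hi⟩ := hH.rician
      intro h0
      have h1 : h i = 0 := by rw [h0]; rfl
      have h2 : Real.sqrt (K / (K + 1)) ≠ 0 := (Real.sqrt_pos.mpr (by positivity)).ne'
      simp [hh, hρ.ne', h2, hi] at h1
    have := norm_pos_iff.mpr hne
    positivity
  · obtain ⟨h1, h2⟩ := integrable_and_integral_exp_gramResidual (ι := Fin NR) (m := m)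
      (by rw [Fintype.card_fin]; omega) hs h
    rw [Fintype.card_fin] at h2
    have e : ∀ ω, Real.exp (s * zfSNR Γs (channelMatrix K Hdn (Hrn ω))) =
        Real.exp (snrScale Γs K RT * s *
          gramResidual (euclideanCols (Hrn ω * C) + Pi.single 0 h)) := by
      intro ω
      rw [hsnr]
      ring_nf
    simp only [e]
    rw [← hlaw] at h1 h2
    constructor
    · exact h1.comp_aemeasurable hmeas
    · rw [integral_map hmeas h1.aestronglyMeasurable] at h2
      rw [h2, hnorm]
      ring_nf

end ZeroForcing

/-! ### Real arguments and assembly -/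

theorem kummer1F1_real_finite_expansion (a b : ℕ) {x : ℝ} (hx : x ≠ 0) :
    kummer1F1 ((a + 1 : ℕ) : ℝ) ((a + b + 2 : ℕ) : ℝ) x =
      kummerAlgPart (a + 1) (a + b + 2) x + Real.exp x * kummerExpPart (a + 1) (a + b + 2) x := by
  rw [← Complex.ofReal_inj, Complex.ofReal_add, Complex.ofReal_mul, Complex.ofReal_exp,
    ofReal_kummer1F1_natCast, ofReal_kummerAlgPart, ofReal_kummerExpPart]
  exact kummer1F1_finite_expansion a b (by exact_mod_cast hx)

theorem mainTheorem4 (NR NT N : ℕ) [NeZero NT] (hle : NT ≤ NR) (hN : N = NR - NT + 1) :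
    -- finite expansion of the confluent hypergeometric function
    (∀ σ : ℂ, Summable (kummerTerm (N : ℂ) (NR : ℂ) σ)) ∧
    (NT = 1 → ∀ σ : ℂ, kummer1F1 (N : ℂ) (NR : ℂ) σ = Complex.exp σ) ∧
    (2 ≤ NT → ∀ σ : ℂ, σ ≠ 0 →
      kummer1F1 (N : ℂ) (NR : ℂ) σ =
        kummerAlgPart N NR σ + Complex.exp σ * kummerExpPart N NR σ) ∧
    -- the m.g.f. of the SNR
    ∀ {Ω : Type*} [MeasurableSpace Ω] (P : Measure Ω) [IsProbabilityMeasure P]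
      (Γs K : ℝ) (Hdn : Matrix (Fin NR) (Fin NT) ℂ) (RT : Matrix (Fin NT) (Fin NT) ℂ)
      (Hrn : Ω → Matrix (Fin NR) (Fin NT) ℂ),
      0 < Γs → IsRicianRayleigh P K Hdn RT Hrn →
      ∀ (γ₁ : Ω → ℝ) (Γ₁ a : ℝ), γ₁ = (fun ω => zfSNR Γs (channelMatrix K Hdn (Hrn ω))) →
        Γ₁ = snrScale Γs K RT → a = ricianParam K Hdn RT →
        ∀ s σ : ℝ, Γ₁ * s < 1 → σ = a * (Γ₁ * s / (1 - Γ₁ * s)) →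
          Integrable (fun ω => Real.exp (s * γ₁ ω)) P ∧
          mgf γ₁ P s = 1 / (1 - Γ₁ * s) ^ N * kummer1F1 (N : ℝ) (NR : ℝ) σ ∧
          (NT = 1 → mgf γ₁ P s = 1 / (1 - Γ₁ * s) ^ N * Real.exp σ) ∧
          (2 ≤ NT → s ≠ 0 →
            mgf γ₁ P s = 1 / (1 - Γ₁ * s) ^ N *
              (kummerAlgPart N NR σ + Real.exp σ * kummerExpPart N NR σ)) := by

  obtain ⟨m, rfl⟩ : ∃ m, NT = m + 1 := Nat.exists_eq_succ_of_ne_zero (NeZero.ne NT)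
  have hN' : N = NR - m := by omega
  have hexp : ∀ σ : ℝ, σ ≠ 0 → 2 ≤ m + 1 → kummer1F1 (N : ℝ) (NR : ℝ) σ =
      kummerAlgPart N NR σ + Real.exp σ * kummerExpPart N NR σ := by
    intro σ hσ h2
    -- Here `NT = b + 2`; the exponents `a = N - 1` and `b = NR - N - 1` are those of Euler's
    -- integral.
    obtain ⟨b, rfl⟩ : ∃ b, m = b + 1 := ⟨m - 1, by omega⟩
    obtain ⟨a, rfl⟩ : ∃ a, NR = a + b + 2 := ⟨NR - b - 2, by omega⟩
    obtain rfl : N = a + 1 := by omega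
    exact kummer1F1_real_finite_expansion a b hσ
  refine ⟨fun σ => summable_kummerTerm_natCast (by omega) (by omega) σ, fun h1 σ => ?_,
    fun h2 σ hσ => ?_, ?_⟩
  · obtain rfl : N = NR := by omega
    exact kummer1F1_natCast_self (by omega) σ
  · obtain ⟨b, rfl⟩ : ∃ b, m = b + 1 := ⟨m - 1, by omega⟩
    obtain ⟨a, rfl⟩ : ∃ a, NR = a + b + 2 := ⟨NR - b - 2, by omega⟩
    obtain rfl : N = a + 1 := by omega
    exact kummer1F1_finite_expansion a b hσ
  · intro Ω _ P _ Γs K Hdn RT Hrn hΓ hH γ₁ Γ₁ a hγ hΓ₁ ha s σ hs hσ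
    subst hγ hΓ₁ ha
    obtain ⟨hΓpos, hapos, key⟩ := integrable_and_mgf_zfSNR hle P hΓ hH
    obtain ⟨hint, hval⟩ := key s hs
    rw [← hN', ← hσ] at hval
    refine ⟨hint, hval, fun h1 => hval.trans ?_, fun h2 hs0 => hval.trans ?_⟩
    · obtain rfl : N = NR := by omega
      congr 1
      rw [← Complex.ofReal_inj, ofReal_kummer1F1_natCast, kummer1F1_natCast_self (by omega),
        Complex.ofReal_exp]
    -- The expansion requires `σ ≠ 0`, which follows from `s ≠ 0` because `a` and `Γ₁` are positive.
    · rw [hexp σ ?_ h2]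
      rw [hσ]
      exact mul_ne_zero hapos.ne' (div_ne_zero (mul_ne_zero hΓpos.ne' hs0) (by linarith))
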